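/- Let $\mathcal M=(V,\mathcal I)$ be a matroid of rank $k$ on a non-empty finite ground set $V=\{0,\dots,n-1\}$, let $U$ be a set with weights $w:U\to\mathbb R_{\ge 0}$, let $(U_v)_{v\in V}$ be finite subsets of $U$, and let $f(S)=\sum_{u\in\bigcup_{s\in S}U_s}w(u)$ for $S\subseteq V$ be the associated coverage function. Suppose that $f$ has frequency bounded by an integer $\mu\ge 1$, i.e. every $u\in U$ lies in at most $\mu$ of the sets $U_v$, and let $0<\varepsilon\le 1$ be real. There exist a single deterministic algorithm and an absolute constant $C$ such that for all such $n,\mathcal M,k,U,w,(U_v),\mu,\varepsilon$ the following holds. Given $n$, $\mu$, $\varepsilon$, an independence oracle for $\mathcal M$ and a value oracle for $f$, the algorithm halts after at most \[ C\cdot(\mu/\varepsilon)^{Ck}\cdot n^{C} \;=\; (\mu/\varepsilon)^{O(k)}\cdot|V|^{O(1)} \] steps and outputs a $(1-\varepsilon)$-approximate solution of the matroid-constrained maximum coverage problem, that is, a set $S\in\mathcal I$ with $f(S)\ge(1-\varepsilon)f(T)$ for every $T\in\mathcal I$. Here an algorithm is a fixed program of a random access machine with natural-number registers and arrays (addition,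 truncated subtraction, comparison), real registers (constant $1$, addition, subtraction, comparison), and a query set $Q\subseteq V$ to which elements can be added or removed one at a time; each elementary operation, each test, and each oracle call (is $Q\in\mathcal I$? what is $f(Q)$?) costs one step, and the output is the set $Q$ at halting. -/

import Mathlib

open scoped NNReal

namespace MatroidCoverage

/-! ### Matroid-constrained maximum coverage -/

open Classical in
/-- The coverage function `f(S) = w(⋃_{s ∈ S} U_s) = ∑_{u ∈ ⋃_{s ∈ S} U_s} w(u)`. -/
noncomputable def coverage {V U : Type*} (w : U → ℝ≥0) (F : V → Finset U) (S : Finset V) : ℝ :=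
  ∑ u ∈ S.biUnion F, (w u : ℝ)

/-- Every element of the universe lies in at most `μ` of the sets `U_v`. -/
def FrequencyBounded {V U : Type*} (F : V → Finset U) (μ : ℕ) : Prop :=
  ∀ u : U, {v : V | u ∈ F v}.encard ≤ μ

/-- `S` is independent, and `f(S) ≥ (1 - ε) · f(T)` for every independent `T`. -/
def IsApproxSolution {V U : Type*} (M : Matroid V) (w : U → ℝ≥0) (F : V → Finset U)
    (ε : ℝ) (S : Finset V) : Prop :=
  M.Indep (S : Set V) ∧
    ∀ T : Finset V, M.Indep (T : Set V) → (1 - ε) * coverage w F T ≤ coverage w F S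

/-! ### The machine model

A random access machine for set functions on the ground set `{0, …, n - 1}`, presented as a
structured imperative language.  It has

* natural-number registers and arrays of natural numbers (with computed indices), with addition,
  truncated subtraction and comparison;
* real registers, with the constant `1`, addition, subtraction and comparison;
* a query set `Q ⊆ {0, …, n - 1}`, changed one element at a time, on which an independence oracle
  and a value oracle can be called.

Multiplication is not available, so that a natural number computed in `t` steps has `O(t)` more
bits than the input.  Every elementary operation, test and oracle call costs one step. -/

/-- Natural-number expressions. -/
inductive NExp : Type
  | lit (c : ℕ)
  | var (x : ℕ)
  | read (a : ℕ) (i : NExp)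
  | add (e₁ e₂ : NExp)
  | sub (e₁ e₂ : NExp)

/-- Real expressions. -/
inductive RExp : Type
  | one
  | var (r : ℕ)
  | add (e₁ e₂ : RExp)
  | sub (e₁ e₂ : RExp)

/-- Tests.  `indep` calls the independence oracle on the current query set. -/
inductive Test : Type
  | le (e₁ e₂ : NExp)
  | rle (e₁ e₂ : RExp)
  | indep
  | not (b : Test)
  | and (b₁ b₂ : Test)

/-- Programs. -/
inductive Prog : Type
  | skip
  /-- assign to a natural-number register -/
  | set (x : ℕ) (e : NExp)
  /-- write the value of `e` into cell `i` of array `a` -/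
  | store (a : ℕ) (i e : NExp)
  /-- assign to a real register -/
  | rset (r : ℕ) (e : RExp)
  /-- add an element to the query set (no effect if it is not in the ground set) -/
  | insert (e : NExp)
  /-- remove an element from the query set -/
  | erase (e : NExp)
  /-- call the value oracle on the query set and put the answer into real register `r` -/
  | value (r : ℕ)
  | seq (p q : Prog)
  | ite (b : Test) (p q : Prog)
  | loop (b : Test) (p : Prog)

/-- Memory of the machine. -/
structure State (n : ℕ) where
  reg : ℕ → ℕ
  arr : ℕ → ℕ → ℕ
  rreg : ℕ → ℝ
  query : Finset (Fin n)

/-- The two oracles. -/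
structure Oracles (n : ℕ) where
  indep : Finset (Fin n) → Prop
  value : Finset (Fin n) → ℝ

/-- Value of an expression. -/
def NExp.eval {n : ℕ} (s : State n) : NExp → ℕ
  | lit c => c
  | var x => s.reg x
  | read a i => s.arr a (i.eval s)
  | add e₁ e₂ => e₁.eval s + e₂.eval s
  | sub e₁ e₂ => e₁.eval s - e₂.eval s

/-- Number of steps for evaluating an expression. -/
def NExp.cost : NExp → ℕ
  | lit _ => 1
  | var _ => 1
  | read _ i => i.cost + 1
  | add e₁ e₂ => e₁.cost + e₂.cost + 1
  | sub e₁ e₂ => e₁.cost + e₂.cost + 1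

/-- Value of a real expression. -/
noncomputable def RExp.eval {n : ℕ} (s : State n) : RExp → ℝ
  | one => 1
  | var r => s.rreg r
  | add e₁ e₂ => e₁.eval s + e₂.eval s
  | sub e₁ e₂ => e₁.eval s - e₂.eval s

/-- Number of steps for evaluating a real expression. -/
def RExp.cost : RExp → ℕ
  | one => 1
  | var _ => 1
  | add e₁ e₂ => e₁.cost + e₂.cost + 1
  | sub e₁ e₂ => e₁.cost + e₂.cost + 1

/-- Outcome of a test. -/
def Test.Holds {n : ℕ} (O : Oracles n) (s : State n) : Test → Prop
  | le e₁ e₂ => e₁.eval s ≤ e₂.eval s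
  | rle e₁ e₂ => e₁.eval s ≤ e₂.eval s
  | indep => O.indep s.query
  | not b => ¬ b.Holds O s
  | and b₁ b₂ => b₁.Holds O s ∧ b₂.Holds O s

/-- Number of steps for a test. -/
def Test.cost : Test → ℕ
  | le e₁ e₂ => e₁.cost + e₂.cost + 1
  | rle e₁ e₂ => e₁.cost + e₂.cost + 1
  | indep => 1
  | not b => b.cost + 1
  | and b₁ b₂ => b₁.cost + b₂.cost + 1

/-- `Exec O p s t s'`: with oracles `O`, program `p` started in state `s` halts after exactly `t`
steps in state `s'`. -/
inductive Exec {n : ℕ} (O : Oracles n) : Prog → State n → ℕ → State n → Prop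
  | skip (s : State n) : Exec O Prog.skip s 1 s
  | set (s : State n) (x : ℕ) (e : NExp) :
      Exec O (Prog.set x e) s (e.cost + 1)
        { s with reg := Function.update s.reg x (e.eval s) }
  | store (s : State n) (a : ℕ) (i e : NExp) :
      Exec O (Prog.store a i e) s (i.cost + e.cost + 1)
        { s with arr := Function.update s.arr a
                          (Function.update (s.arr a) (i.eval s) (e.eval s)) }
  | rset (s : State n) (r : ℕ) (e : RExp) :
      Exec O (Prog.rset r e) s (e.cost + 1)
        { s with rreg := Function.update s.rreg r (e.eval s) }
  | insert (s : State n) (e : NExp) :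
      Exec O (Prog.insert e) s (e.cost + 1)
        { s with query := if h : e.eval s < n then Insert.insert ⟨e.eval s, h⟩ s.query
                          else s.query }
  | erase (s : State n) (e : NExp) :
      Exec O (Prog.erase e) s (e.cost + 1)
        { s with query := if h : e.eval s < n then s.query.erase ⟨e.eval s, h⟩
                          else s.query }
  | value (s : State n) (r : ℕ) :
      Exec O (Prog.value r) s 1
        { s with rreg := Function.update s.rreg r (O.value s.query) }
  | seq {p q : Prog} {s s₁ s₂ : State n} {t₁ t₂ : ℕ} :
      Exec O p s t₁ s₁ → Exec O q s₁ t₂ s₂ → Exec O (Prog.seq p q) s (t₁ + t₂) s₂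
  | ite_true {b : Test} {p q : Prog} {s s' : State n} {t : ℕ} :
      b.Holds O s → Exec O p s t s' → Exec O (Prog.ite b p q) s (b.cost + t) s'
  | ite_false {b : Test} {p q : Prog} {s s' : State n} {t : ℕ} :
      ¬ b.Holds O s → Exec O q s t s' → Exec O (Prog.ite b p q) s (b.cost + t) s'
  | loop_true {b : Test} {p : Prog} {s s₁ s₂ : State n} {t₁ t₂ : ℕ} :
      b.Holds O s → Exec O p s t₁ s₁ → Exec O (Prog.loop b p) s₁ t₂ s₂ →
        Exec O (Prog.loop b p) s (b.cost + t₁ + t₂) s₂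
  | loop_false {b : Test} {p : Prog} {s : State n} :
      ¬ b.Holds O s → Exec O (Prog.loop b p) s b.cost s

/-- The oracles of an instance: independence in the matroid, and the coverage function. -/
noncomputable def oracles {n : ℕ} {U : Type*} (M : Matroid (Fin n)) (w : U → ℝ≥0)
    (F : Fin n → Finset U) : Oracles n where
  indep S := M.Indep (S : Set (Fin n))
  value S := coverage w F S

/-- Initial state: natural register `0` holds `n = |V|`, natural register `1` holds the frequency
bound `μ`, real register `0` holds `ε`; all the rest is zero and the query set is empty. -/
noncomputable def initState (n μ : ℕ) (ε : ℝ) : State n where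
  reg x := if x = 0 then n else if x = 1 then μ else 0
  arr _ _ := 0
  rreg r := if r = 0 then ε else 0
  query := ∅

/-- Started on the instance, `P` halts after at most `B` steps, and the set that it then leaves
in the query set is a `(1 - ε)`-approximate solution. -/
def SolvesWithin {n : ℕ} {U : Type*} (P : Prog) (M : Matroid (Fin n)) (w : U → ℝ≥0)
    (F : Fin n → Finset U) (μ : ℕ) (ε : ℝ) (B : ℝ) : Prop :=
  ∃ (t : ℕ) (s : State n), Exec (oracles M w F) P (initState n μ ε) t s ∧
    (t : ℝ) ≤ B ∧ IsApproxSolution M w F ε s.query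

end MatroidCoverage

/-! The algorithm reduces the ground set to a small kernel and then searches the kernel
exhaustively. Elements are sorted by their singleton values, and `ρ = ⌈μ/ε⌉` disjoint layers are
peeled off, each a greedy maximum-weight basis of what the earlier layers left. The kernel is the
union of the layers. It has at most `ρ * k` elements, and an element outside it is spanned, in every
layer, by elements at least as heavy (`IsLayering`).

The kernel loses little (`IsLayering.exists_approx`). Split an optimal set `O` into its kernel part
`A` and the rest `P`, and let `T` be a best independent kernel set containing `A`, extended to a
basis of the kernel. For each layer, `exists_heavier_replacement` turns `P` into heavier elements of
that layer that are still independent together with `A`, and `exists_exchange_injection` pairs these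
injectively with elements of `T \ A` for which single swaps keep `T` independent. By maximality of
`T`, the value of an incoming element is at most the loss from the outgoing one plus its overlap
with what remains. Sum this over all layers. A universe element is lost at most once per layer, and
its overlaps are limited by the frequency bound because all incoming elements are distinct
(`sum_swap_covers_le`). This yields `ρ f(O) ≤ (ρ + μ - 1) f(T)`, hence a factor `1 + ε`.

The kernel has at most `(3ρ)^k` independent subsets (`IsLayering.card_extensions_le`). A
backtracking search visits each of them with polynomial overhead, because every branch it enters is
independent (`exists_loopReaches_search`). If `μ = 1` or the rank is zero, the first layer is
already optimal and the search is skipped. -/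

namespace MatroidCoverage

/-! ### Matroid exchange lemmas. -/

section Exchange

variable {V : Type*} [DecidableEq V] {M : Matroid V}

/-- If every element of `P` is spanned by the elements of `B` that are at least as heavy, then `P`
can be replaced in the independent set `A ∪ P` by at least as heavy elements of `B`. -/
theorem exists_heavier_replacement (c : V → ℝ) (B : Set V) (P : Finset V) :
    ∀ A : Finset V, Disjoint A P → M.Indep ((A ∪ P : Finset V) : Set V) →
      (∀ p ∈ P, p ∈ M.closure {b | b ∈ B ∧ c p ≤ c b}) →
      ∃ φ : V → V, Set.InjOn φ P ∧ (∀ p ∈ P, φ p ∈ B ∧ c p ≤ c (φ p) ∧ φ p ∉ A) ∧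
        M.Indep ((A ∪ P.image φ : Finset V) : Set V) := by
  induction P using Finset.induction_on with
  | empty => intro A _ hI _; exact ⟨id, by simp, by simp, by simpa using hI⟩
  | insert p P hp ih =>
    intro A hd hI h
    have hpA : p ∉ A := fun hA => (Finset.disjoint_left.1 hd hA) (Finset.mem_insert_self _ _)
    have hI' : M.Indep (insert p ((A ∪ P : Finset V) : Set V)) := by
      convert hI using 1; ext; simp
    have hsub : ((A ∪ P : Finset V) : Set V) ⊆ M.E := (Set.subset_insert _ _).trans hI'.subset_ground
    have hpc : p ∉ M.closure ((A ∪ P : Finset V) : Set V) := by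
      have := (hI'.subset (Set.subset_insert _ _)).insert_indep_iff.1 hI'
      rcases this with h1 | h1
      · exact h1.2
      · exfalso; simp at h1; tauto
    -- If `A ∪ P` spanned all the heavier elements of `B`, it would span `p` as well. So some `y` is
    -- free to replace `p`; it then joins `A` for the induction.
    obtain ⟨y, ⟨hyB, hyc⟩, hy⟩ : ∃ y ∈ {b | b ∈ B ∧ c p ≤ c b},
        y ∈ M.E \ M.closure ((A ∪ P : Finset V) : Set V) := by
      by_contra hcon
      push Not at hcon
      apply hpc
      have hp' := h p (Finset.mem_insert_self _ _)
      rw [← M.closure_inter_ground] at hp'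
      refine M.closure_subset_closure_of_subset_closure ?_ hp'
      rintro b ⟨hb, hbE⟩
      by_contra hb'
      exact hcon b hb ⟨hbE, hb'⟩
    have hyI : M.Indep (insert y ((A ∪ P : Finset V) : Set V)) :=
      (hI'.subset (Set.subset_insert _ _)).insert_indep_iff.2 (Or.inl hy)
    have hyAP : y ∉ A ∪ P := fun hmem => hy.2 (M.mem_closure_of_mem (by exact_mod_cast hmem) hsub)
    obtain ⟨φ, hφ, hφP, hφI⟩ := ih (insert y A) (by
        rw [Finset.disjoint_insert_left]
        exact ⟨fun h => hyAP (Finset.mem_union_right _ h),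
          hd.mono_right (Finset.subset_insert _ _)⟩)
      (by convert hyI using 1; ext; simp)
      (fun q hq => h q (Finset.mem_insert_of_mem hq))
    have hne : ∀ q ∈ P, Function.update φ p y q = φ q := fun q hq => by
      rw [Function.update_of_ne]; rintro rfl; exact hp hq
    refine ⟨Function.update φ p y, ?_, ?_, ?_⟩
    · intro a ha b hb hab
      simp only [Finset.coe_insert, Set.mem_insert_iff, Finset.mem_coe] at ha hb
      rcases ha with rfl | ha <;> rcases hb with rfl | hb
      · rfl
      · rw [hne b hb, Function.update_self] at hab
        exact absurd (hab ▸ Finset.mem_insert_self y A) (hφP b hb).2.2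
      · rw [hne a ha, Function.update_self] at hab
        exact absurd (hab ▸ Finset.mem_insert_self y A) (hφP a ha).2.2
      · rw [hne a ha, hne b hb] at hab; exact hφ ha hb hab
    · intro q hq
      rcases Finset.mem_insert.1 hq with rfl | hq
      · rw [Function.update_self]
        exact ⟨hyB, hyc, fun h => hyAP (Finset.mem_union_left _ h)⟩
      · rw [hne q hq]
        exact ⟨(hφP q hq).1, (hφP q hq).2.1, fun h => (hφP q hq).2.2 (Finset.mem_insert_of_mem h)⟩
    · have : (insert p P).image (Function.update φ p y) = insert y (P.image φ) := by
        rw [Finset.image_insert, Function.update_self, Finset.image_congr hne]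
      rw [this]
      convert hφI using 2
      ext; simp

/-- Simultaneous single exchanges between an independent set and a set that it spans, fixing `A`. -/
theorem exists_exchange_injection {T A Y : Finset V} (hT : M.Indep (T : Set V)) (hA : A ⊆ T)
    (hAY : M.Indep ((A ∪ Y : Finset V) : Set V)) (hd : Disjoint A Y)
    (hY : (Y : Set V) ⊆ M.closure T) :
    ∃ π : V → V, Set.InjOn π Y ∧
      ∀ y ∈ Y, π y ∈ T \ A ∧ y ∉ M.closure ((T.erase (π y) : Finset V) : Set V) := by
  classical
  -- `N y` is the set of elements outside `A` that `y` may replace in `T`: the fundamental circuit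
  -- of `y`, or `{y}` when `y ∈ T`.
  let N : Y → Finset V := fun y => (T \ A).filter fun t => (y : V) ∉ M.closure ((T.erase t : Finset V) : Set V)
  have key : ∀ y : Y, (y : V) ∈ M.closure ((A ∪ N y : Finset V) : Set V) := by
    intro y
    by_contra hy
    have hyT := hY y.2
    -- Elements outside `A ∪ N y` can be deleted from `T` one at a time without losing `y` from the
    -- closure: for subsets of an independent set, closure commutes with intersection.
    have : ∀ R : Finset V, R ⊆ T \ (A ∪ N y) → (y : V) ∈ M.closure ((T \ R : Finset V) : Set V) := by
      intro R hR
      induction R using Finset.induction_on with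
      | empty => simpa using hyT
      | insert t R ht ih =>
        have h1 := ih ((Finset.subset_insert _ _).trans hR)
        have h2 : (y : V) ∈ M.closure ((T.erase t : Finset V) : Set V) := by
          have := hR (Finset.mem_insert_self t R)
          simp only [N, Finset.mem_sdiff, Finset.mem_union, Finset.mem_filter] at this
          by_contra hc
          exact this.2 (Or.inr ⟨⟨this.1, fun h => this.2 (Or.inl h)⟩, hc⟩)
        have h3 : M.Indep (((T \ R : Finset V) : Set V) ∪ ((T.erase t : Finset V) : Set V)) :=
          hT.subset (by intro z; simp; tauto)
        have h4 : ((T \ insert t R : Finset V) : Set V) =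
            ((T \ R : Finset V) : Set V) ∩ ((T.erase t : Finset V) : Set V) := by
          ext z; simp; tauto
        rw [h4, h3.closure_inter_eq_inter_closure]
        exact ⟨h1, h2⟩
    refine hy ?_
    have h := this (T \ (A ∪ N y)) subset_rfl
    rwa [Finset.sdiff_sdiff_eq_self] at h
    intro z hz
    rcases Finset.mem_union.1 hz with hz | hz
    · exact hA hz
    · exact (Finset.mem_sdiff.1 (Finset.mem_filter.1 hz).1).1
  -- Hall's condition is a rank count: `A ∪ s` is independent and spanned by `A ∪ s.biUnion N`, and
  -- `A` is disjoint from `s`.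
  have hall : ∀ s : Finset Y, s.card ≤ (s.biUnion N).card := by
    intro s
    have hsub : ((A ∪ s.map (Function.Embedding.subtype _) : Finset V) : Set V) ⊆
        M.closure ((A ∪ s.biUnion N : Finset V) : Set V) := by
      intro z hz
      simp only [Finset.coe_union, Set.mem_union, Finset.mem_coe, Finset.mem_map,
        Function.Embedding.subtype_apply] at hz
      have hE : ((A ∪ s.biUnion N : Finset V) : Set V) ⊆ M.E := by
        refine Set.Subset.trans ?_ hT.subset_ground
        intro z hz
        simp only [N, Finset.coe_union, Set.mem_union, Finset.mem_coe, Finset.mem_biUnion,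
          Finset.mem_filter, Finset.mem_sdiff] at hz
        rcases hz with hz | ⟨_, _, hz⟩
        · exact hA hz
        · exact hz.1.1
      rcases hz with hz | ⟨y, hy, rfl⟩
      · exact M.mem_closure_of_mem (by simp [hz]) hE
      · refine M.closure_subset_closure ?_ (key y)
        exact_mod_cast Finset.union_subset_union_right (Finset.subset_biUnion_of_mem N hy)
    have hI : M.Indep ((A ∪ s.map (Function.Embedding.subtype _) : Finset V) : Set V) := by
      refine hAY.subset ?_
      intro z; simp; tauto
    have h1 := hI.encard_le_eRk_of_subset hsub
    rw [M.eRk_closure_eq] at h1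
    have h2 := h1.trans (M.eRk_le_encard _)
    rw [Set.encard_coe_eq_coe_finsetCard, Set.encard_coe_eq_coe_finsetCard, Nat.cast_le,
      Finset.card_union_of_disjoint, Finset.card_map] at h2
    · have := Finset.card_union_le A (s.biUnion N)
      omega
    · refine hd.mono_right ?_
      intro z; simp; tauto
  obtain ⟨f, hf, hfN⟩ := (Finset.all_card_le_biUnion_card_iff_exists_injective N).1 hall
  refine ⟨fun v => if h : v ∈ Y then f ⟨v, h⟩ else v, ?_, ?_⟩
  · intro a ha b hb hab
    simp only [Finset.mem_coe] at ha hb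
    simp only [ha, hb, dif_pos] at hab
    simpa using hf hab
  · intro y hy
    have := hfN ⟨y, hy⟩
    simp only [N, Finset.mem_filter] at this
    simpa only [hy, dif_pos] using this

end Exchange

/-! ### Approximation quality of the kernel. -/

section Kernel

variable {V U : Type*}

open Classical in
/-- Indicator of `u` being covered by `S`. -/
noncomputable def covers (F : V → Finset U) (S : Finset V) (u : U) : ℝ :=
  if ∃ s ∈ S, u ∈ F s then 1 else 0

theorem covers_nonneg (F : V → Finset U) (S : Finset V) (u : U) : 0 ≤ covers F S u := by
  unfold covers; split_ifs <;> norm_num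

/-- The index set no longer depends on `S`, so inequalities between coverage values can be checked
one universe element at a time. -/
theorem coverage_eq_sum [Fintype V] [DecidableEq U] (w : U → ℝ≥0) (F : V → Finset U)
    (S : Finset V) :
    coverage w F S = ∑ u ∈ Finset.univ.biUnion F, (w u : ℝ) * covers F S u := by
  classical
  unfold coverage covers
  simp only [mul_ite, mul_one, mul_zero]
  rw [← Finset.sum_filter]
  refine Finset.sum_congr ?_ fun _ _ => rfl
  ext u; simp only [Finset.mem_biUnion, Finset.mem_filter, Finset.mem_univ, true_and]
  constructor
  · rintro ⟨s, hs, hu⟩; exact ⟨⟨s, hu⟩, s, hs, hu⟩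
  · rintro ⟨_, h⟩; exact h

theorem coverage_mono (w : U → ℝ≥0) (F : V → Finset U) {S T : Finset V} (h : S ⊆ T) :
    coverage w F S ≤ coverage w F T := by
  classical
  exact Finset.sum_le_sum_of_subset_of_nonneg (Finset.biUnion_subset_biUnion_of_subset_left _ h)
    fun _ _ _ => NNReal.coe_nonneg _

@[simp] theorem coverage_empty (w : U → ℝ≥0) (F : V → Finset U) : coverage w F ∅ = 0 := by
  simp [coverage]

theorem coverage_nonneg (w : U → ℝ≥0) (F : V → Finset U) (S : Finset V) : 0 ≤ coverage w F S :=
  Finset.sum_nonneg fun _ _ => NNReal.coe_nonneg _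

theorem FrequencyBounded.card_filter_le [Fintype V] {F : V → Finset U} {μ : ℕ}
    (hF : FrequencyBounded F μ) (u : U) [DecidablePred fun v => u ∈ F v] :
    (Finset.univ.filter fun v => u ∈ F v).card ≤ μ := by
  have := hF u
  rw [← Nat.cast_le (α := ℕ∞), ← Set.encard_coe_eq_coe_finsetCard]
  simpa using this

/-- `L` labels the elements of `ρ` disjoint independent layers by `1, …, ρ`, and each unlabelled
element is spanned by the at least as heavy elements of every layer. -/
structure IsLayering (M : Matroid V) (c : V → ℝ) (ρ : ℕ) (L : V → ℕ) : Prop where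
  le : ∀ v, L v ≤ ρ
  indep : ∀ j, 1 ≤ j → j ≤ ρ → M.Indep {v | L v = j}
  spanned : ∀ v, L v = 0 → ∀ j, 1 ≤ j → j ≤ ρ → v ∈ M.closure {u | L u = j ∧ c v ≤ c u}

variable [Fintype V] [DecidableEq V] {M : Matroid V}

/-- The pointwise estimate behind the kernel bound: the swaps `T - t + y`, taken over all pairs of
a layer `j` and an element `o`, charge each element of the universe a bounded number of times. -/
theorem sum_swap_covers_le {F : V → Finset U} {m : ℕ} (hF : FrequencyBounded F (m + 1))
    {T A P : Finset V} (hAT : A ⊆ T) (ρ : ℕ) (hρ : 1 ≤ ρ) (t y : ℕ → V → V)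
    (ht : ∀ j < ρ, Set.InjOn (t j) P) (htT : ∀ j < ρ, ∀ o ∈ P, t j o ∈ T \ A)
    (hy : ∀ j < ρ, ∀ j' < ρ, ∀ o ∈ P, ∀ o' ∈ P, y j o = y j' o' → j = j' ∧ o = o')
    (hyA : ∀ j < ρ, ∀ o ∈ P, y j o ∉ A)
    (hyT : ∀ j < ρ, ∀ o ∈ P, y j o ∉ T.erase (t j o)) (u : U) :
    ∑ q ∈ Finset.range ρ ×ˢ P, (covers F T u - covers F (T.erase (t q.1 q.2)) u +
        covers F {y q.1 q.2} u * covers F (T.erase (t q.1 q.2)) u) ≤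
      ρ * (covers F T u - covers F A u) + m * covers F T u := by
  classical
  by_cases hT : ∃ s ∈ T, u ∈ F s
  swap
  · have h0 : ∀ S ⊆ T, covers F S u = 0 := fun S hS => by
      unfold covers; rw [if_neg]; rintro ⟨s, hs, hu⟩; exact hT ⟨s, hS hs, hu⟩
    rw [Finset.sum_eq_zero]
    · simp [h0 T subset_rfl, h0 A hAT]
    · intro q _; simp [h0 T subset_rfl, h0 _ (T.erase_subset _)]
  have hT1 : covers F T u = 1 := if_pos hT
  set Z := Finset.range ρ ×ˢ P with hZ
  have hZm : ∀ q ∈ Z, q.1 < ρ ∧ q.2 ∈ P := fun q hq => by simpa [hZ] using hq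
  -- the swaps whose incoming element covers `u`
  have hcount : ∀ (R : Finset V), (∀ v ∈ R, u ∈ F v) → ∀ Z' ⊆ Z,
      (∀ q ∈ Z', u ∈ F (y q.1 q.2) ∧ y q.1 q.2 ∉ R) → Z'.card + R.card ≤ m + 1 := by
    intro R hR Z' hZ' hq
    have hinj : Set.InjOn (fun q : ℕ × V => y q.1 q.2) Z' := by
      intro a ha b hb hab
      have h1 := hZm a (hZ' ha); have h2 := hZm b (hZ' hb)
      exact Prod.ext_iff.2 (hy _ h1.1 _ h2.1 _ h1.2 _ h2.2 hab)
    rw [← Finset.card_image_of_injOn hinj, ← Finset.card_union_of_disjoint]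
    · refine (Finset.card_le_card ?_).trans (hF.card_filter_le u)
      intro v hv
      rcases Finset.mem_union.1 hv with hv | hv
      · obtain ⟨q, hq', rfl⟩ := Finset.mem_image.1 hv
        simpa using (hq q hq').1
      · simpa using hR v hv
    · rw [Finset.disjoint_left]
      intro v hv
      obtain ⟨q, hq', rfl⟩ := Finset.mem_image.1 hv
      exact (hq q hq').2
  -- Removing an element of `T \ A` can uncover `u` only if that element is the sole cover of `u` in
  -- `T`.
  by_cases hU : ∃ s ∈ T \ A, u ∈ F s ∧ ∀ s' ∈ T, u ∈ F s' → s' = s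
  · obtain ⟨s, hs, hus, huniq⟩ := hU
    have hsT := (Finset.mem_sdiff.1 hs).1
    have hA0 : covers F A u = 0 := by
      unfold covers; rw [if_neg]; rintro ⟨a, ha, hu⟩
      have := huniq a (hAT ha) hu
      exact (Finset.mem_sdiff.1 hs).2 (this ▸ ha)
    have herase : ∀ x, covers F (T.erase x) u = if x = s then 0 else 1 := by
      intro x; unfold covers
      by_cases hx : x = s
      · rw [if_pos hx, if_neg]; rintro ⟨a, ha, hu⟩
        have := huniq a (Finset.mem_of_mem_erase ha) hu
        exact Finset.ne_of_mem_erase ha (this.trans hx.symm)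
      · rw [if_neg hx, if_pos]; exact ⟨s, Finset.mem_erase.2 ⟨fun h => hx h.symm, hsT⟩, hus⟩
    have hterm : ∀ q ∈ Z, (covers F T u - covers F (T.erase (t q.1 q.2)) u +
        covers F {y q.1 q.2} u * covers F (T.erase (t q.1 q.2)) u) =
        (if t q.1 q.2 = s then 1 else 0) +
          (if t q.1 q.2 ≠ s ∧ u ∈ F (y q.1 q.2) then 1 else 0) := by
      intro q _
      rw [hT1, herase]
      by_cases h1 : t q.1 q.2 = s <;> by_cases h2 : u ∈ F (y q.1 q.2) <;> simp [h1, h2, covers]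
    rw [Finset.sum_congr rfl hterm, Finset.sum_add_distrib, ← Finset.sum_filter,
      ← Finset.sum_filter, Finset.sum_const, Finset.sum_const, hT1, hA0]
    -- Each layer removes `s` at most once, since `t j` is injective on `P`.
    have c1 : (Z.filter fun q => t q.1 q.2 = s).card ≤ ρ := by
      have : Set.InjOn Prod.fst ((Z.filter fun q => t q.1 q.2 = s : Finset (ℕ × V)) : Set (ℕ × V)) := by
        intro a ha b hb hab
        rw [Finset.mem_coe, Finset.mem_filter] at ha hb
        refine Prod.ext hab (ht a.1 (hZm a ha.1).1 (hZm a ha.1).2 (hZm b hb.1).2 ?_)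
        rw [ha.2, hab, hb.2]
      calc _ = ((Z.filter fun q => t q.1 q.2 = s).image Prod.fst).card :=
            (Finset.card_image_of_injOn this).symm
        _ ≤ (Finset.range ρ).card := Finset.card_le_card (by
            intro j hj
            obtain ⟨q, hq, rfl⟩ := Finset.mem_image.1 hj
            exact Finset.mem_range.2 (hZm q (Finset.mem_filter.1 hq).1).1)
        _ = ρ := Finset.card_range ρ
    -- When `s` stays in `T`, the incoming element differs from `s`. Thus `s` uses up one of the `m
    -- + 1` possible covers of `u`.
    have c2 := hcount {s} (by simpa using hus)
      (Z.filter fun q => t q.1 q.2 ≠ s ∧ u ∈ F (y q.1 q.2)) (Finset.filter_subset _ _) (by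
        intro q hq
        obtain ⟨hqZ, h1, h2⟩ := Finset.mem_filter.1 hq
        refine ⟨h2, fun h => hyT q.1 (hZm q hqZ).1 q.2 (hZm q hqZ).2 ?_⟩
        rw [Finset.mem_singleton.1 h]
        exact Finset.mem_erase.2 ⟨fun h => h1 h.symm, hsT⟩)
    rw [Finset.card_singleton] at c2
    have c1' : ((Z.filter fun q => t q.1 q.2 = s).card : ℝ) ≤ ρ := by exact_mod_cast c1
    have c2' : ((Z.filter fun q => t q.1 q.2 ≠ s ∧ u ∈ F (y q.1 q.2)).card : ℝ) ≤ m := by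
      exact Nat.cast_le.2 (by omega)
    simp only [nsmul_eq_mul, mul_one, sub_zero]
    linarith
  · have herase : ∀ x ∈ T \ A, covers F (T.erase x) u = 1 := by
      intro x hx; unfold covers; rw [if_pos]
      by_contra hcon
      push Not at hcon
      obtain ⟨s, hs, hu⟩ := hT
      have hall : ∀ s' ∈ T, u ∈ F s' → s' = x := fun s' hs' hu' => by
        by_contra hne; exact hcon s' (Finset.mem_erase.2 ⟨hne, hs'⟩) hu'
      have := hall s hs hu
      subst this
      exact hU ⟨s, hx, hu, hall⟩
    have hterm : ∀ q ∈ Z, (covers F T u - covers F (T.erase (t q.1 q.2)) u +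
        covers F {y q.1 q.2} u * covers F (T.erase (t q.1 q.2)) u) =
          (if u ∈ F (y q.1 q.2) then 1 else 0) := by
      intro q hq
      rw [hT1, herase _ (htT q.1 (hZm q hq).1 q.2 (hZm q hq).2)]
      simp [covers]
    rw [Finset.sum_congr rfl hterm, ← Finset.sum_filter, Finset.sum_const, hT1]
    simp only [nsmul_eq_mul, mul_one]
    by_cases hA : ∃ a ∈ A, u ∈ F a
    · obtain ⟨a, ha, hua⟩ := hA
      have c := hcount {a} (by simpa using hua)
        (Z.filter fun q => u ∈ F (y q.1 q.2)) (Finset.filter_subset _ _) (by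
          intro q hq
          obtain ⟨hqZ, h2⟩ := Finset.mem_filter.1 hq
          refine ⟨h2, fun h => hyA q.1 (hZm q hqZ).1 q.2 (hZm q hqZ).2 ?_⟩
          rwa [Finset.mem_singleton.1 h])
      rw [Finset.card_singleton] at c
      have c' : ((Z.filter fun q => u ∈ F (y q.1 q.2)).card : ℝ) ≤ m := by
        exact Nat.cast_le.2 (by omega)
      have : covers F A u = 1 := if_pos ⟨a, ha, hua⟩
      rw [this]; linarith
    -- No cover of `u` can be set aside here, because an incoming element may itself lie in `T`. The
    -- extra unit is absorbed by the term `ρ`, as `A` does not cover `u`.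
    · have c := hcount ∅ (by simp)
        (Z.filter fun q => u ∈ F (y q.1 q.2)) (Finset.filter_subset _ _) (by
          intro q hq
          exact ⟨(Finset.mem_filter.1 hq).2, by simp⟩)
      have c' : ((Z.filter fun q => u ∈ F (y q.1 q.2)).card : ℝ) ≤ m + 1 := by
        exact_mod_cast (by simpa using c)
      have : covers F A u = 0 := if_neg hA
      rw [this]
      have : (1 : ℝ) ≤ ρ := by exact_mod_cast hρ
      linarith

/-- The labelled elements of a layering with `ρ` layers contain an independent set that is
optimal up to a factor `ρ / (ρ + μ - 1)`, where `μ = m + 1` bounds the frequency. -/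
theorem IsLayering.exists_approx {w : U → ℝ≥0} {F : V → Finset U} {m ρ : ℕ} {L : V → ℕ}
    (hL : IsLayering M (fun v => coverage w F {v}) ρ L) (hF : FrequencyBounded F (m + 1))
    (hρ : 1 ≤ ρ) (O : Finset V) (hO : M.Indep (O : Set V)) :
    ∃ T : Finset V, (∀ v ∈ T, L v ≠ 0) ∧ M.Indep (T : Set V) ∧
      ρ * coverage w F O ≤ (ρ + m) * coverage w F T := by
  classical
  set A := O.filter fun v => L v ≠ 0 with hA
  set P := O.filter fun v => L v = 0 with hP
  have hdAP : Disjoint A P := by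
    rw [Finset.disjoint_left]; intro v hv hv'
    exact (Finset.mem_filter.1 hv).2 (Finset.mem_filter.1 hv').2
  have hAP : A ∪ P = O := by ext v; simp [hA, hP]; tauto
  -- the optimal set between `A` and the kernel
  let Cand : Finset (Finset V) :=
    Finset.univ.filter fun T => A ⊆ T ∧ (∀ v ∈ T, L v ≠ 0) ∧ M.Indep (T : Set V)
  have hAC : A ∈ Cand := by
    simp only [Cand, Finset.mem_filter, Finset.mem_univ, true_and]
    exact ⟨subset_rfl, fun v hv => (Finset.mem_filter.1 hv).2,
      hO.subset (by exact_mod_cast Finset.filter_subset _ _)⟩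
  obtain ⟨T₀, hT₀, hmax₀⟩ := Finset.exists_max_image Cand (coverage w F) ⟨A, hAC⟩
  simp only [Cand, Finset.mem_filter, Finset.mem_univ, true_and] at hT₀ hmax₀
  -- Extending to a basis of the kernel makes every layer spanned, as the exchange lemma requires;
  -- monotonicity of coverage preserves maximality.
  obtain ⟨T₁, hT₁, hT₀₁⟩ := hT₀.2.2.subset_isBasis'_of_subset (X := {v | L v ≠ 0})
    (fun v hv => hT₀.2.1 v hv)
  obtain ⟨T, rfl⟩ : ∃ T : Finset V, (T : Set V) = T₁ := ⟨T₁.toFinite.toFinset, by simp⟩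
  have hTL : ∀ v ∈ T, L v ≠ 0 := fun v hv => hT₁.subset hv
  have hAT : A ⊆ T := hT₀.1.trans (by exact_mod_cast hT₀₁)
  have hTI := hT₁.indep
  have hmax : ∀ S : Finset V, A ⊆ S → (∀ v ∈ S, L v ≠ 0) → M.Indep (S : Set V) →
      coverage w F S ≤ coverage w F T := fun S h1 h2 h3 =>
    (hmax₀ S ⟨h1, h2, h3⟩).trans (coverage_mono w F (by exact_mod_cast hT₀₁))
  refine ⟨T, hTL, hTI, ?_⟩
  -- the swaps
  have hswap : ∀ j : ℕ, ∃ y t : V → V, j < ρ → Set.InjOn y P ∧ Set.InjOn t P ∧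
      ∀ o ∈ P, L (y o) = j + 1 ∧ coverage w F {o} ≤ coverage w F {y o} ∧ y o ∉ A ∧
        t o ∈ T \ A ∧ y o ∉ T.erase (t o) ∧
        M.Indep ((insert (y o) (T.erase (t o)) : Finset V) : Set V) := by
    intro j
    by_cases hj : j < ρ
    swap
    · exact ⟨id, id, fun h => absurd h hj⟩
    obtain ⟨φ, hφ, hφP, hφI⟩ := exists_heavier_replacement (M := M)
      (fun v => coverage w F {v}) {u | L u = j + 1} P A hdAP (by rwa [hAP])
      (fun p hp => hL.spanned p (Finset.mem_filter.1 hp).2 (j + 1) (by omega) (by omega))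
    obtain ⟨π, hπ, hπY⟩ := exists_exchange_injection hTI hAT hφI
      (by
        rw [Finset.disjoint_right]; intro v hv
        obtain ⟨p, hp, rfl⟩ := Finset.mem_image.1 hv
        exact (hφP p hp).2.2)
      (by
        intro v hv
        obtain ⟨p, hp, rfl⟩ := Finset.mem_image.1 (Finset.mem_coe.1 hv)
        rw [hT₁.closure_eq_closure]
        have hmem : φ p ∈ M.E := hφI.subset_ground (by simp; exact Or.inr ⟨p, hp, rfl⟩)
        refine M.mem_closure_of_mem' ?_ hmem
        have := (hφP p hp).1
        simp only [Set.mem_ofPred_eq] at this ⊢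
        omega)
    refine ⟨φ, fun o => π (φ o), fun _ => ⟨hφ, ?_, ?_⟩⟩
    · intro a ha b hb hab
      exact hφ ha hb (hπ (by simpa using ⟨a, ha, rfl⟩) (by simpa using ⟨b, hb, rfl⟩) hab)
    · intro o ho
      have h1 := hφP o ho
      have h2 := hπY (φ o) (Finset.mem_image_of_mem _ ho)
      have hE : φ o ∈ M.E := hφI.subset_ground (by simp; exact Or.inr ⟨o, ho, rfl⟩)
      have hI : M.Indep ((T.erase (π (φ o)) : Finset V) : Set V) :=
        hTI.subset (by exact_mod_cast T.erase_subset _)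
      refine ⟨h1.1, h1.2.1, h1.2.2, h2.1, fun h => h2.2 ?_, ?_⟩
      · exact M.mem_closure_of_mem (by exact_mod_cast h) hI.subset_ground
      · rw [Finset.coe_insert]
        exact hI.insert_indep_iff.2 (Or.inl ⟨hE, h2.2⟩)
  choose y t hyt using hswap
  set Ω : Finset U := Finset.univ.biUnion F
  -- The swapped set still contains `A`, so it competes with `T`. Inclusion–exclusion for the
  -- incoming element turns its non-improvement into this bound.
  have hlocal : ∀ q ∈ Finset.range ρ ×ˢ P, coverage w F {q.2} ≤
      ∑ u ∈ Ω, (w u : ℝ) * (covers F T u - covers F (T.erase (t q.1 q.2)) u +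
        covers F {y q.1 q.2} u * covers F (T.erase (t q.1 q.2)) u) := by
    intro q hq
    obtain ⟨hq1, hq2⟩ : q.1 < ρ ∧ q.2 ∈ P := by simpa using hq
    obtain ⟨h1, h2, h3, h4, h5, h6⟩ := (hyt q.1 hq1).2.2 q.2 hq2
    have hle := hmax (insert (y q.1 q.2) (T.erase (t q.1 q.2)))
      (fun a ha => Finset.mem_insert_of_mem (Finset.mem_erase.2
        ⟨fun h => (Finset.mem_sdiff.1 h4).2 (h ▸ ha), hAT ha⟩))
      (by
        intro v hv
        rcases Finset.mem_insert.1 hv with rfl | hv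
        · omega
        · exact hTL v (Finset.mem_of_mem_erase hv)) h6
    have hcov : ∀ u, covers F (insert (y q.1 q.2) (T.erase (t q.1 q.2))) u =
        covers F (T.erase (t q.1 q.2)) u + covers F {y q.1 q.2} u -
          covers F {y q.1 q.2} u * covers F (T.erase (t q.1 q.2)) u := by
      intro u
      unfold covers
      simp only [Finset.exists_mem_insert, Finset.mem_singleton, exists_eq_left]
      by_cases ha : u ∈ F (y q.1 q.2) <;>
        by_cases hb : ∃ s ∈ T.erase (t q.1 q.2), u ∈ F s <;> simp only [ha, hb] <;> norm_num
    calc coverage w F {q.2} ≤ coverage w F {y q.1 q.2} := h2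
      _ ≤ coverage w F {y q.1 q.2} + (coverage w F T -
          coverage w F (insert (y q.1 q.2) (T.erase (t q.1 q.2)))) := by linarith
      _ = _ := by
          simp only [coverage_eq_sum]
          rw [← Finset.sum_sub_distrib, ← Finset.sum_add_distrib]
          refine Finset.sum_congr rfl fun u _ => ?_
          rw [hcov]; ring
  have hsum : ∑ q ∈ Finset.range ρ ×ˢ P, coverage w F {q.2} ≤
      ρ * (coverage w F T - coverage w F A) + m * coverage w F T := by
    refine (Finset.sum_le_sum hlocal).trans ?_
    rw [Finset.sum_comm]
    simp only [← Finset.mul_sum, coverage_eq_sum]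
    rw [← Finset.sum_sub_distrib, Finset.mul_sum, Finset.mul_sum, ← Finset.sum_add_distrib]
    refine Finset.sum_le_sum fun u _ => ?_
    have := sum_swap_covers_le hF hAT ρ hρ t y (fun j hj => (hyt j hj).2.1)
      (fun j hj o ho => ((hyt j hj).2.2 o ho).2.2.2.1)
      (by
        intro j hj j' hj' o ho o' ho' heq
        have e1 := ((hyt j hj).2.2 o ho).1
        have e2 := ((hyt j' hj').2.2 o' ho').1
        rw [heq, e2] at e1
        have : j' = j := by omega
        subst this
        exact ⟨rfl, (hyt j' hj).1 ho ho' heq⟩)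
      (fun j hj o ho => ((hyt j hj).2.2 o ho).2.2.1)
      (fun j hj o ho => ((hyt j hj).2.2 o ho).2.2.2.2.1) u
    have := mul_le_mul_of_nonneg_left this (NNReal.coe_nonneg (w u))
    refine this.trans (le_of_eq ?_)
    ring
  have hsub : coverage w F O ≤ coverage w F A + ∑ o ∈ P, coverage w F {o} := by
    simp only [coverage_eq_sum]
    rw [Finset.sum_comm, ← Finset.sum_add_distrib]
    refine Finset.sum_le_sum fun u _ => ?_
    rw [← Finset.mul_sum, ← mul_add]
    refine mul_le_mul_of_nonneg_left ?_ (NNReal.coe_nonneg _)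
    have hnn : ∀ o ∈ P, 0 ≤ covers F {o} u := fun o _ => covers_nonneg F _ u
    by_cases h : ∃ s ∈ O, u ∈ F s
    · obtain ⟨s, hs, hu⟩ := h
      rw [← hAP] at hs
      have h1 : covers F O u = 1 := if_pos ⟨s, hAP ▸ hs, hu⟩
      rw [h1]
      rcases Finset.mem_union.1 hs with hs | hs
      · have : covers F A u = 1 := if_pos ⟨s, hs, hu⟩
        have := Finset.sum_nonneg hnn
        linarith
      · have e : covers F {s} u = 1 := if_pos ⟨s, by simp, hu⟩
        have := Finset.single_le_sum hnn hs
        have := covers_nonneg F A u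
        linarith
    · have : covers F O u = 0 := if_neg h
      rw [this]
      exact add_nonneg (covers_nonneg F A u) (Finset.sum_nonneg hnn)
  rw [Finset.sum_product] at hsum
  simp only [Finset.sum_const, Finset.card_range, nsmul_eq_mul] at hsum
  have := mul_le_mul_of_nonneg_left hsub (Nat.cast_nonneg (α := ℝ) ρ)
  linarith

end Kernel

/-! ### Timed total correctness -/

section Logic

variable {n : ℕ} {O : Oracles n}

/-- Started in `s`, the program `p` halts within `B` steps in a state satisfying `Q`. -/
def Runs (O : Oracles n) (p : Prog) (s : State n) (B : ℕ) (Q : State n → Prop) : Prop :=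
  ∃ (t : ℕ) (s' : State n), Exec O p s t s' ∧ t ≤ B ∧ Q s'

theorem Runs.mono {p : Prog} {s : State n} {B B' : ℕ} {Q Q' : State n → Prop}
    (h : Runs O p s B Q) (hB : B ≤ B') (hQ : ∀ s', Q s' → Q' s') : Runs O p s B' Q' := by
  obtain ⟨t, s', he, ht, hq⟩ := h
  exact ⟨t, s', he, ht.trans hB, hQ _ hq⟩

theorem Runs.seq {p q : Prog} {s : State n} {B B' : ℕ} {P Q : State n → Prop}
    (hp : Runs O p s B P) (hq : ∀ s', P s' → Runs O q s' B' Q) :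
    Runs O (Prog.seq p q) s (B + B') Q := by
  obtain ⟨t, s', he, ht, h⟩ := hp
  obtain ⟨t', s'', he', ht', h'⟩ := hq s' h
  exact ⟨t + t', s'', Exec.seq he he', by omega, h'⟩

theorem Runs.ite {b : Test} {p q : Prog} {s : State n} {B : ℕ} {Q : State n → Prop}
    (hp : b.Holds O s → Runs O p s B Q) (hq : ¬ b.Holds O s → Runs O q s B Q) :
    Runs O (Prog.ite b p q) s (b.cost + B) Q := by
  by_cases h : b.Holds O s
  · obtain ⟨t, s', he, ht, h'⟩ := hp h
    exact ⟨_, s', Exec.ite_true h he, by omega, h'⟩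
  · obtain ⟨t, s', he, ht, hQ⟩ := hq h
    exact ⟨_, s', Exec.ite_false h he, by omega, hQ⟩

/-- Weakest precondition of a loop-free program. -/
def wp (O : Oracles n) : Prog → (State n → Prop) → State n → Prop
  | .skip, Q, s => Q s
  | .set x e, Q, s => Q { s with reg := Function.update s.reg x (e.eval s) }
  | .store a i e, Q, s =>
      Q { s with arr := Function.update s.arr a
                          (Function.update (s.arr a) (i.eval s) (e.eval s)) }
  | .rset r e, Q, s => Q { s with rreg := Function.update s.rreg r (e.eval s) }
  | .insert e, Q, s =>
      Q { s with query := if h : e.eval s < n then Insert.insert ⟨e.eval s, h⟩ s.query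
                          else s.query }
  | .erase e, Q, s =>
      Q { s with query := if h : e.eval s < n then s.query.erase ⟨e.eval s, h⟩
                          else s.query }
  | .value r, Q, s => Q { s with rreg := Function.update s.rreg r (O.value s.query) }
  | .seq p q, Q, s => wp O p (wp O q Q) s
  | .ite b p q, Q, s => (b.Holds O s → wp O p Q s) ∧ (¬ b.Holds O s → wp O q Q s)
  | .loop _ _, _, _ => False

/-- Bound on the number of steps of a loop-free program. -/
def Prog.maxCost : Prog → ℕ
  | .skip => 1
  | .set _ e => e.cost + 1
  | .store _ i e => i.cost + e.cost + 1
  | .rset _ e => e.cost + 1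
  | .insert e => e.cost + 1
  | .erase e => e.cost + 1
  | .value _ => 1
  | .seq p q => p.maxCost + q.maxCost
  | .ite b p q => b.cost + max p.maxCost q.maxCost
  | .loop _ _ => 0

/-- The value `0` of `Prog.maxCost` on loops does no harm, because `wp` is false there. -/
theorem Runs.of_wp {p : Prog} : ∀ {s : State n} {Q : State n → Prop}, wp O p Q s →
    Runs O p s p.maxCost Q := by
  induction p with
  | skip => intro s Q h; exact ⟨_, _, Exec.skip s, le_rfl, h⟩
  | set x e => intro s Q h; exact ⟨_, _, Exec.set s x e, le_rfl, h⟩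
  | store a i e => intro s Q h; exact ⟨_, _, Exec.store s a i e, le_rfl, h⟩
  | rset r e => intro s Q h; exact ⟨_, _, Exec.rset s r e, le_rfl, h⟩
  | insert e => intro s Q h; exact ⟨_, _, Exec.insert s e, le_rfl, h⟩
  | erase e => intro s Q h; exact ⟨_, _, Exec.erase s e, le_rfl, h⟩
  | value r => intro s Q h; exact ⟨_, _, Exec.value s r, le_rfl, h⟩
  | seq p q ihp ihq => intro s Q h; exact (ihp h).seq fun s' hs' => ihq hs'
  | ite b p q ihp ihq =>
    intro s Q h
    exact Runs.ite (fun hb => (ihp (h.1 hb)).mono (le_max_left _ _) fun _ => id)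
      fun hb => (ihq (h.2 hb)).mono (le_max_right _ _) fun _ => id
  | loop b p => intro s Q h; exact h.elim

/-- A loop that makes exactly `N` iterations. -/
theorem Runs.loop {b : Test} {p : Prog} {N c : ℕ} (I : ℕ → State n → Prop)
    (hstep : ∀ i < N, ∀ s, I i s → b.Holds O s ∧ Runs O p s c (I (i + 1)))
    (hend : ∀ s, I N s → ¬ b.Holds O s) {s : State n} (h0 : I 0 s) :
    Runs O (Prog.loop b p) s (N * (b.cost + c) + b.cost) (I N) := by
  suffices h : ∀ d i s, i + d = N → I i s →
      Runs O (Prog.loop b p) s (d * (b.cost + c) + b.cost) (I N) from h N 0 s (by omega) h0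
  intro d
  induction d with
  | zero =>
    intro i s hi hs
    obtain rfl : i = N := by omega
    exact ⟨_, s, Exec.loop_false (hend s hs), by omega, hs⟩
  | succ d ih =>
    intro i s hi hs
    obtain ⟨hb, t, s', he, ht, hs'⟩ := hstep i (by omega) s hs
    obtain ⟨t', s'', he', ht', hs''⟩ := ih (i + 1) s' (by omega) hs'
    refine ⟨_, s'', Exec.loop_true hb he he', ?_, hs''⟩
    rw [Nat.succ_mul]; omega

/-- `e₁ < e₂`. -/
def Test.lt (e₁ e₂ : NExp) : Test := .le (.add e₁ (.lit 1)) e₂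

/-- Increment a register. -/
def Prog.incr (x : ℕ) : Prog := .set x (.add (.var x) (.lit 1))

/-- Run `p` with register `x` counting from `0` up to `e - 1`. -/
def Prog.forBelow (x : ℕ) (e : NExp) (p : Prog) : Prog :=
  .seq (.set x (.lit 0)) (.loop (.lt (.var x) e) (.seq p (.incr x)))

/-- Each round costs `c` for the body, `e.cost + 4` for the test and `4` for the increment. The two
extra rounds in the bound pay for initialisation and the final failing test. -/
theorem Runs.forBelow {x : ℕ} {e : NExp} {p : Prog} {N c : ℕ} (I : ℕ → State n → Prop)
    {s : State n} (h0 : I 0 { s with reg := Function.update s.reg x 0 })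
    (hx : ∀ i s, I i s → s.reg x = i ∧ e.eval s = N)
    (hstep : ∀ i < N, ∀ s, I i s → Runs O p s c
      (fun s' => I (i + 1) { s' with reg := Function.update s'.reg x (s'.reg x + 1) })) :
    Runs O (Prog.forBelow x e p) s ((N + 2) * (c + e.cost + 8)) (I N) := by
  have h1 : Runs O (Prog.set x (.lit 0)) s 2 (I 0) := Runs.of_wp (by simpa [wp, NExp.eval] using h0)
  refine (h1.seq fun s' hs' => Runs.loop (N := N) (c := c + 4) I ?_ ?_ hs').mono ?_ fun _ => id
  · intro i hi s hs
    refine ⟨?_, (hstep i hi s hs).seq fun s' hs' => ?_⟩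
    · simp only [Test.lt, Test.Holds, NExp.eval, (hx i s hs).1, (hx i s hs).2]; omega
    · exact Runs.of_wp (p := Prog.incr x) (by simpa [wp, Prog.incr, NExp.eval] using hs')
  · intro s hs
    simp only [Test.lt, Test.Holds, NExp.eval, (hx N s hs).1, (hx N s hs).2]; omega
  · simp only [Test.lt, Test.cost, NExp.cost]
    ring_nf
    nlinarith

end Logic

/-! ### The program

Array `0` lists the ground set by decreasing value, array `1` holds the layer labels, array `2` is
the stack of the search and array `3` the best set found so far. -/

namespace Algo

open Prog

/-- Compare the elements in registers `2` and `3`, and count in register `4` if the latter comes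
first; real register `1` holds the value of the former. -/
def countIfBefore : Prog :=
  seq (insert (.var 3)) <| seq (value 2) <| seq (erase (.var 3)) <|
  ite (.rle (.var 1) (.var 2))
    (ite (.rle (.var 2) (.var 1)) (ite (.lt (.var 3) (.var 2)) (incr 4) skip) (incr 4)) skip

/-- Put real register `1` to the value of the element in register `2`. -/
def evalElement : Prog :=
  seq (insert (.var 2)) <| seq (value 1) <| seq (erase (.var 2)) (set 4 (.lit 0))

/-- Sort the ground set by decreasing value into array `0`. -/
def sort : Prog :=
  forBelow 2 (.var 0) <| seq evalElement <| seq (forBelow 3 (.var 0) countIfBefore)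
    (store 0 (.var 4) (.var 2))

/-- Empty the query set. -/
def clear : Prog := forBelow 2 (.var 0) (erase (.var 2))

/-- Try to put the next element into the current layer. -/
def layerStep : Prog :=
  seq (set 3 (.read 0 (.var 2))) <|
  ite (.le (.read 1 (.var 3)) (.lit 0))
    (seq (insert (.var 3)) (ite .indep (seq (store 1 (.var 3) (.var 5)) (incr 6)) (erase (.var 3))))
    skip

/-- Greedily build the layer with the label in register `5`; register `6` counts its elements. -/
def layer : Prog := seq clear <| seq (set 6 (.lit 0)) (forBelow 2 (.var 0) layerStep)

/-- Build further layers until there are at least `μ / ε`. -/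
def layers : Prog :=
  seq (rset 3 (.sub .one .one)) <| seq (forBelow 2 (.var 1) (rset 3 (.add (.var 3) .one))) <|
  seq (rset 4 (.var 0)) <|
  loop (.not (.rle (.var 3) (.var 4))) <|
    seq (incr 5) <| seq layer (rset 4 (.add (.var 4) (.var 0)))

/-- Search step at a labelled or unlabelled element in register `2`. -/
def descend : Prog :=
  seq (ite (.le (.lit 1) (.read 1 (.var 2)))
    (seq (insert (.var 2)) (ite .indep (seq (store 2 (.var 3) (.var 2)) (incr 3)) (erase (.var 2))))
    skip) (incr 2)

/-- Copy the stack into array `3`. -/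
def record : Prog :=
  seq (rset 1 (.var 2)) <| seq (set 6 (.var 3)) <|
    forBelow 7 (.var 3) (store 3 (.var 7) (.read 2 (.var 7)))

/-- Remove the top of the stack, or stop the search if the stack is empty. -/
def backtrack : Prog :=
  ite (.le (.lit 1) (.var 3))
    (seq (set 3 (.sub (.var 3) (.lit 1))) <| seq (set 2 (.read 2 (.var 3))) <|
      seq (erase (.var 2)) (incr 2))
    (set 4 (.lit 0))

/-- Compare the query set with the best set found so far. -/
def evaluate : Prog := seq (value 2) (ite (.rle (.var 2) (.var 1)) skip record)

/-- Treat a set found by the search. -/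
def leaf : Prog := seq evaluate backtrack

/-- One step of the search. -/
def searchStep : Prog := ite (.lt (.var 2) (.var 0)) descend leaf

/-- Initialise the search. -/
def searchInit : Prog :=
  seq (set 2 (.lit 0)) <| seq (set 3 (.lit 0)) <| seq (set 4 (.lit 1)) <| seq (set 6 (.lit 0))
    (rset 1 (.sub .one .one))

/-- Best independent set of labelled elements. -/
def search : Prog :=
  seq clear <| seq searchInit <| seq (loop (.le (.lit 1) (.var 4)) searchStep) <|
    forBelow 7 (.var 6) (insert (.read 3 (.var 7)))

/-- The algorithm. -/
def main : Prog :=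
  seq sort <| seq (set 5 (.lit 1)) <| seq layer <|
    ite (.and (.le (.lit 2) (.var 1)) (.le (.lit 1) (.var 6))) (seq layers search) skip

end Algo

/-! ### Sorting and layers -/

section Sorting

variable {n : ℕ}

theorem card_filter_val_lt_succ (P : Fin n → Prop) [DecidablePred P] (i : Fin n) :
    (Finset.univ.filter fun u : Fin n => u.1 < i.1 + 1 ∧ P u).card =
      (Finset.univ.filter fun u : Fin n => u.1 < i.1 ∧ P u).card + if P i then 1 else 0 := by
  split_ifs with h
  · rw [← Finset.card_insert_of_notMem (a := i) (by simp)]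
    congr 1; ext u
    simp only [Finset.mem_filter, Finset.mem_univ, true_and, Finset.mem_insert]
    constructor
    · rintro ⟨h1, h2⟩
      by_cases hu : u = i
      · exact Or.inl hu
      · have : u.1 ≠ i.1 := fun h => hu (Fin.ext h)
        exact Or.inr ⟨by omega, h2⟩
    · rintro (rfl | ⟨h1, h2⟩)
      · exact ⟨by omega, h⟩
      · exact ⟨by omega, h2⟩
  · rw [add_zero]; refine congrArg Finset.card ?_; ext u
    simp only [Finset.mem_filter, Finset.mem_univ, true_and]
    constructor
    · rintro ⟨h1, h2⟩
      have : u.1 ≠ i.1 := fun h' => h (Fin.ext h' ▸ h2)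
      exact ⟨by omega, h2⟩
    · rintro ⟨h1, h2⟩; exact ⟨by omega, h2⟩

/-- `u` comes before `v` when sorting by decreasing `c`, ties being broken by index. -/
def Before (c : Fin n → ℝ) (u v : Fin n) : Prop := c v < c u ∨ c v = c u ∧ u < v

open Classical in
/-- Number of the first `i` elements that come before `v`. -/
noncomputable def position (c : Fin n → ℝ) (i : ℕ) (v : Fin n) : ℕ :=
  (Finset.univ.filter fun u : Fin n => u.1 < i ∧ Before c u v).card

theorem Before.irrefl {c : Fin n → ℝ} {v : Fin n} : ¬ Before c v v := by
  simp [Before]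

theorem Before.trans {c : Fin n → ℝ} {u v x : Fin n} (h : Before c u v) (h' : Before c v x) :
    Before c u x := by
  rcases h with h | ⟨h1, h2⟩ <;> rcases h' with h' | ⟨h1', h2'⟩
  · exact Or.inl (h'.trans h)
  · exact Or.inl (h1' ▸ h)
  · exact Or.inl (h1 ▸ h')
  · exact Or.inr ⟨h1'.trans h1, h2.trans h2'⟩

theorem Before.total {c : Fin n → ℝ} {u v : Fin n} (h : u ≠ v) : Before c u v ∨ Before c v u := by
  rcases lt_trichotomy (c u) (c v) with h1 | h1 | h1
  · exact Or.inr (Or.inl h1)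
  · rcases lt_or_gt_of_ne h with h2 | h2
    · exact Or.inl (Or.inr ⟨h1.symm, h2⟩)
    · exact Or.inr (Or.inr ⟨h1, h2⟩)
  · exact Or.inl (Or.inl h1)

theorem position_lt_position {c : Fin n → ℝ} {u v : Fin n} (h : Before c u v) :
    position c n u < position c n v := by
  classical
  unfold position
  refine Finset.card_lt_card (Finset.ssubset_iff_of_subset ?_ |>.2 ⟨u, ?_, ?_⟩)
  · intro x
    simp only [Finset.mem_filter, Finset.mem_univ, true_and]
    exact fun hx => ⟨hx.1, hx.2.trans h⟩
  · simpa using h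
  · simpa using Before.irrefl

theorem position_lt (c : Fin n → ℝ) (v : Fin n) : position c n v < n := by
  classical
  have : (Finset.univ.filter fun u : Fin n => u.1 < n ∧ Before c u v).card <
      (Finset.univ : Finset (Fin n)).card :=
    Finset.card_lt_card (Finset.ssubset_iff_of_subset (Finset.subset_univ _) |>.2
      ⟨v, by simp, by simpa using Before.irrefl⟩)
  simpa [position] using this

/-- The array `a` lists the ground set by decreasing `c`. -/
def IsSorting (c : Fin n → ℝ) (a : ℕ → ℕ) : Prop :=
  ∃ σ : Equiv.Perm (Fin n), (∀ p : Fin n, a p = σ p) ∧ ∀ p q, p ≤ q → c (σ q) ≤ c (σ p)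

/-- `Before` is a strict total order, so positions are pairwise distinct numbers below `n` and
define a permutation. -/
theorem isSorting_of_position {c : Fin n → ℝ} {a : ℕ → ℕ}
    (h : ∀ v : Fin n, a (position c n v) = v) : IsSorting c a := by
  let π : Fin n → Fin n := fun v => ⟨position c n v, position_lt c v⟩
  have hπ : Function.Injective π := by
    intro u v huv
    by_contra hne
    have huv' : position c n u = position c n v := congrArg Fin.val huv
    rcases Before.total (c := c) hne with h1 | h1
    · exact absurd huv' (position_lt_position h1).ne
    · exact absurd huv' (position_lt_position h1).ne'
  let e := Equiv.ofBijective π (Finite.injective_iff_bijective.1 hπ)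
  refine ⟨e.symm, fun p => ?_, fun p q hpq => ?_⟩
  · have := h (e.symm p)
    have h2 : position c n (e.symm p) = p := congrArg Fin.val (e.apply_symm_apply p)
    rwa [h2] at this
  · by_contra hlt
    push Not at hlt
    have h1 := position_lt_position (c := c) (u := e.symm q) (v := e.symm p) (Or.inl hlt)
    have h2 : position c n (e.symm p) = p := congrArg Fin.val (e.apply_symm_apply p)
    have h3 : position c n (e.symm q) = q := congrArg Fin.val (e.apply_symm_apply q)
    rw [h2, h3] at h1
    exact absurd hpq (not_le.2 h1)

end Sorting

/-! ### Sorting and construction of a single greedy layer. -/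

section Phases

variable {n : ℕ} {O : Oracles n}

open Algo

/-- The registers that hold the input. -/
def Input (μ : ℕ) (ε : ℝ) (s : State n) : Prop := s.reg 0 = n ∧ s.reg 1 = μ ∧ s.rreg 0 = ε

/-- Invariant of the inner loop of the sorting phase. -/
def CountInv (O : Oracles n) (μ : ℕ) (ε : ℝ) (a : ℕ → ℕ → ℕ) (v : Fin n) (i : ℕ) (s : State n) :
    Prop :=
  Input μ ε s ∧ s.query = ∅ ∧ s.reg 2 = v ∧ s.reg 3 = i ∧
    s.reg 4 = position (fun v => O.value {v}) i v ∧ s.rreg 1 = O.value {v} ∧ s.arr = a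

theorem runs_countIfBefore {μ : ℕ} {ε : ℝ} {a : ℕ → ℕ → ℕ} {v : Fin n} {i : ℕ} (hi : i < n)
    {s : State n} (hs : CountInv O μ ε a v i s) :
    Runs O countIfBefore s 25 fun s' =>
      CountInv O μ ε a v (i + 1) { s' with reg := Function.update s'.reg 3 (s'.reg 3 + 1) } := by
  classical
  have hpos : position (fun v => O.value {v}) (i + 1) v = position (fun v => O.value {v}) i v +
      if Before (fun v => O.value {v}) ⟨i, hi⟩ v then 1 else 0 :=
    card_filter_val_lt_succ (fun u => Before (fun v => O.value {v}) u v) ⟨i, hi⟩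
  obtain ⟨⟨e0, e1, e2⟩, hq, h2, h3, h4, hr, ha⟩ := hs
  obtain ⟨reg, arr, rreg, query⟩ := s
  dsimp only at *
  subst hq
  refine (Runs.of_wp (p := countIfBefore) ?_).mono (by decide) fun _ => id
  simp [wp, countIfBefore, Prog.incr, Test.lt, Test.Holds, NExp.eval, RExp.eval, CountInv, Input,
    e0, e1, e2, h2, h3, h4, hr, hi, ha, hpos]
  refine ⟨fun ha => ⟨fun hb => ⟨fun hc => ?_, fun hc => ?_⟩, fun hb => ?_⟩, fun ha => ?_⟩
  · exact Or.inr ⟨le_antisymm ha hb, hc⟩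
  · rintro (h | ⟨_, h⟩)
    · exact absurd h (not_lt.2 hb)
    · exact absurd h (not_lt.2 hc)
  · exact Or.inl hb
  · rintro (h | ⟨h, _⟩)
    · exact absurd h (not_lt.2 ha.le)
    · exact ha.ne h.symm

/-- Invariant of the outer loop of the sorting phase. -/
def SortInv (O : Oracles n) (μ : ℕ) (ε : ℝ) (i : ℕ) (s : State n) : Prop :=
  Input μ ε s ∧ s.query = ∅ ∧ s.reg 2 = i ∧ (∀ v, s.arr 1 v = 0) ∧
    ∀ v : Fin n, v.1 < i → s.arr 0 (position (fun v => O.value {v}) n v) = v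

/-- Sorting is by rank: each element is written to the cell whose index is the number of elements
before it. Ranks are distinct, so no entry is overwritten. -/
theorem runs_sort {μ : ℕ} {ε : ℝ} :
    Runs O sort (initState n μ ε) (60 * (n + 2) * (n + 2)) fun s' =>
      Input μ ε s' ∧ (∀ v, s'.arr 1 v = 0) ∧ IsSorting (fun v => O.value {v}) (s'.arr 0) := by
  refine (Runs.forBelow (N := n) (c := 9 + ((n + 2) * (25 + 1 + 8) + 4)) (SortInv O μ ε) ?_ ?_ ?_).mono
    ?_ ?_
  · simp [SortInv, Input, initState]
  · rintro i s ⟨⟨h0, -⟩, -, h2, -⟩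
    exact ⟨h2, h0⟩
  · rintro i hi s ⟨⟨e0, e1, e2⟩, hq, h2, h1, ha⟩
    have hm : Runs O evalElement s 9 fun s' => ∃ a, a = s.arr ∧
        CountInv O μ ε a ⟨i, hi⟩ 0 { s' with reg := Function.update s'.reg 3 0 } := by
      refine (Runs.of_wp (p := evalElement) ?_).mono (by decide) fun _ => id
      simp [wp, evalElement, NExp.eval, CountInv, Input, e0, e1, e2, hq, h2, hi, position]
    refine hm.seq ?_
    rintro s₁ ⟨a, rfl, hs₁⟩
    refine (Runs.forBelow (N := n) (c := 25) (CountInv O μ ε s.arr ⟨i, hi⟩) hs₁ ?_ ?_).seq ?_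
    · rintro j s' ⟨⟨h0, -⟩, -, -, h3, -⟩
      exact ⟨h3, h0⟩
    · intro j hj s' hs'
      exact runs_countIfBefore hj hs'
    · rintro s₂ ⟨⟨e0', e1', e2'⟩, hq', h2', h3', h4', hr', ha'⟩
      refine (Runs.of_wp (p := .store 0 (.var 4) (.var 2)) ?_).mono (by decide) fun _ => id
      simp [wp, NExp.eval, SortInv, Input, e0', e1', e2', hq', h2', h4', ha', h1]
      intro v hv
      rw [Function.update_apply]
      split_ifs with hp
      · by_contra hne
        have hne' : v ≠ ⟨i, hi⟩ := fun h => hne (by rw [h])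
        rcases Before.total (c := fun v => O.value {v}) hne' with h | h
        · exact absurd hp (position_lt_position h).ne
        · exact absurd hp (position_lt_position h).ne'
      · refine ha v ?_
        have : v.1 ≠ i := fun h => hp (by congr; exact Fin.ext h)
        omega
  · simp only [NExp.cost]
    nlinarith
  · rintro s ⟨hin, -, -, h1, ha⟩
    exact ⟨hin, h1, isSorting_of_position fun v => ha v v.2⟩

theorem runs_clear {s : State n} (h0 : s.reg 0 = n) :
    Runs O clear s (11 * (n + 2)) fun s' =>
      s' = { s with reg := Function.update s.reg 2 n, query := ∅ } := by
  refine (Runs.forBelow (N := n) (c := 2) (fun i s' => s' = { s with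
      reg := Function.update s.reg 2 i, query := s.query.filter fun v => i ≤ v.1 })
    ?_ ?_ ?_).mono ?_ ?_
  · simp
  · rintro i s' rfl
    simp [NExp.eval, h0]
  · rintro i hi s' rfl
    refine (Runs.of_wp (p := .erase (.var 2)) ?_).mono (by decide) fun _ => id
    simp only [wp, NExp.eval, Function.update_self, hi, dif_pos, Function.update_idem,
      State.mk.injEq, true_and]
    ext v
    simp only [Finset.mem_erase, Finset.mem_filter, ne_eq, Fin.ext_iff]
    constructor
    · rintro ⟨h1, h2, h3⟩; exact ⟨h2, by omega⟩
    · rintro ⟨h2, h3⟩; exact ⟨by omega, h2, by omega⟩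
  · simp only [NExp.cost]; linarith
  · rintro s' rfl
    simp only [State.mk.injEq, true_and]
    ext v; simp

/-- Facts about the memory that the construction of the layers preserves. -/
def LayerFrame (s s' : State n) : Prop :=
  s'.reg 0 = s.reg 0 ∧ s'.reg 1 = s.reg 1 ∧ s'.reg 5 = s.reg 5 ∧ s'.rreg = s.rreg ∧
    s'.arr 0 = s.arr 0

/-- Invariant of the construction of the layer with label `i + 1`. -/
def LayerInv (M : Matroid (Fin n)) (c : Fin n → ℝ) (σ : Equiv.Perm (Fin n)) (i : ℕ) (s₀ : State n)
    (p : ℕ) (s : State n) : Prop :=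
  LayerFrame s₀ s ∧ s.reg 2 = p ∧ (s.query.Nonempty → 1 ≤ s.reg 6) ∧
    (1 ≤ s.reg 6 → s.query.Nonempty) ∧
    (∀ v : Fin n, v ∈ s.query ↔ s.arr 1 v = i + 1) ∧
    (∀ v : Fin n, s.arr 1 v ≤ i + 1) ∧
    (∀ v : Fin n, s.arr 1 v = i + 1 → (σ.symm v).1 < p) ∧
    (∀ j, 1 ≤ j → j ≤ i + 1 → M.Indep {v : Fin n | s.arr 1 v = j}) ∧
    ∀ v : Fin n, s.arr 1 v = 0 → ∀ j, 1 ≤ j → (j ≤ i ∨ j = i + 1 ∧ (σ.symm v).1 < p) →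
      v ∈ M.closure {u : Fin n | s.arr 1 u = j ∧ c v ≤ c u}

theorem runs_layerStep {M : Matroid (Fin n)} (hM : M.E = Set.univ)
    (hO : ∀ S, O.indep S ↔ M.Indep S) {c : Fin n → ℝ} {i : ℕ} {s₀ s : State n}
    {σ : Equiv.Perm (Fin n)} (hσ : ∀ p : Fin n, s₀.arr 0 p = σ p)
    (hmono : ∀ p q, p ≤ q → c (σ q) ≤ c (σ p)) (h5 : s₀.reg 5 = i + 1) {p : ℕ} (hp : p < n)
    (hs : LayerInv M c σ i s₀ p s) :
    Runs O layerStep s 24 fun s' =>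
      LayerInv M c σ i s₀ (p + 1) { s' with reg := Function.update s'.reg 2 (s'.reg 2 + 1) } := by
  obtain ⟨⟨f0, f1, f5, fr, fa⟩, h2, h6, h6', hq, hle, hlt, hI, hsp⟩ := hs
  obtain ⟨v, hv⟩ : ∃ v, v = σ ⟨p, hp⟩ := ⟨_, rfl⟩
  have hvp : (σ.symm v).1 = p := by rw [hv]; simp
  have hav : s.arr 0 p = v := by rw [fa, hσ ⟨p, hp⟩, hv]
  have huniq : ∀ u : Fin n, (σ.symm u).1 < p + 1 → u ≠ v → (σ.symm u).1 < p := by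
    intro u hu hne
    have : (σ.symm u).1 ≠ p := fun h => hne (by
      rw [hv, ← Equiv.symm_apply_eq]; exact Fin.ext h)
    omega
  have hheavy : ∀ u : Fin n, (σ.symm u).1 < p → c v ≤ c u := by
    intro u hu
    have := hmono (σ.symm u) ⟨p, hp⟩ (by rw [Fin.le_def]; exact hu.le)
    rwa [← hv, Equiv.apply_symm_apply] at this
  have hqs : (s.query : Set (Fin n)) = {u : Fin n | s.arr 1 u = i + 1} := by
    ext u; simp [hq]
  refine (Runs.of_wp (p := layerStep) ?_).mono (by decide) fun _ => id
  simp only [wp, layerStep, Prog.incr, Test.Holds, NExp.eval, h2, hav, v.2, dif_pos,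
    Function.update_self, Function.update_of_ne, ne_eq, Nat.reduceEqDiff,
    not_false_eq_true, f5, h5, hO, Fin.eta]
  refine ⟨fun hv0 => ⟨fun hind => ?_, fun hind => ?_⟩, fun hv0 => ?_⟩
  · have hv0' : s.arr 1 v = 0 := by omega
    have hL : ∀ u : Fin n, Function.update (s.arr 1) v (i + 1) u = if u = v then i + 1
        else s.arr 1 u := fun u => by
      simp only [Function.update_apply, Fin.ext_iff]
    simp only [LayerInv, LayerFrame, Function.update_self, hL]
    refine ⟨?_, ?_, ?_, ?_, ?_, ?_, ?_, ?_, ?_⟩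
    · simp [f0, f1, f5, fr, fa]
    · simp
    · simp
    · simp
    · intro u
      rw [Finset.mem_insert, hq]
      by_cases h : u = v <;> simp [h]
    · intro u
      split_ifs
      · exact le_rfl
      · exact hle u
    · intro u hu
      split_ifs at hu with h
      · rw [h, hvp]; omega
      · exact (hlt u hu).trans (by omega)
    · intro j hj hj'
      rcases hj'.lt_or_eq with h | rfl
      · convert hI j hj hj' using 2
        ext u
        by_cases hu : u = v
        · subst hu; rw [if_pos rfl, hv0']; omega
        · rw [if_neg hu]
      · convert hind using 1
        rw [Finset.coe_insert, hqs]
        ext u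
        by_cases hu : u = v <;> simp [hu]
    · intro u hu j hj hj'
      split_ifs at hu with h
      -- The relabelled `v` had label `0`, so it belonged to no earlier spanning set and these sets
      -- only grow.
      refine M.closure_subset_closure ?_ (hsp u hu j hj (hj'.imp id fun h' => ⟨h'.1, huniq u h'.2 h⟩))
      rintro x ⟨hx, hx'⟩
      refine ⟨?_, hx'⟩
      have : x ≠ v := by rintro rfl; omega
      rw [if_neg this]; exact hx
  · have hvq : v ∉ s.query := by rw [hq]; omega
    simp only [LayerInv, LayerFrame, Function.update_self, Finset.erase_insert hvq]
    refine ⟨?_, ?_, ?_, ?_, hq, hle, fun u hu => (hlt u hu).trans (by omega), hI, ?_⟩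
    · simp [f0, f1, f5, fr, fa]
    · simp
    · simpa using h6
    · simpa using h6'
    · intro u hu j hj hj'
      -- A rejected `v` is spanned by the current layer. The members of that layer precede `v` in
      -- the sorted order, so they are at least as heavy.
      by_cases h : u = v ∧ j = i + 1
      · obtain ⟨rfl, rfl⟩ := h
        have hQI : M.Indep (s.query : Set (Fin n)) := hqs ▸ hI (i + 1) hj le_rfl
        have hmem : u ∈ M.closure (s.query : Set (Fin n)) := by
          by_contra hcl
          refine hind ?_
          rw [Finset.coe_insert]
          exact hQI.insert_indep_iff.2 (Or.inl ⟨hM ▸ Set.mem_univ u, hcl⟩)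
        refine M.closure_subset_closure ?_ hmem
        intro x hx
        have hx' := (hq x).1 hx
        exact ⟨hx', hheavy x (hlt x hx')⟩
      · refine hsp u hu j hj ?_
        rcases hj' with h' | ⟨h1, h2⟩
        · exact Or.inl h'
        · exact Or.inr ⟨h1, huniq u h2 fun h' => h ⟨h', h1⟩⟩
  · simp only [LayerInv, LayerFrame, Function.update_self]
    refine ⟨?_, ?_, ?_, ?_, hq, hle, fun u hu => (hlt u hu).trans (by omega), hI, ?_⟩
    · simp [f0, f1, f5, fr, fa]
    · simp
    · simpa using h6
    · simpa using h6'
    · intro u hu j hj hj'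
      refine hsp u hu j hj (hj'.imp id fun h' => ⟨h'.1, huniq u h'.2 ?_⟩)
      rintro rfl
      omega

theorem runs_layer {M : Matroid (Fin n)} (hM : M.E = Set.univ) (hO : ∀ S, O.indep S ↔ M.Indep S)
    {c : Fin n → ℝ} {i : ℕ} {s : State n} (h0 : s.reg 0 = n) (h5 : s.reg 5 = i + 1)
    (hsort : IsSorting c (s.arr 0)) (hL : IsLayering M c i fun v => s.arr 1 v) :
    Runs O layer s (60 * (n + 2)) fun s' => LayerFrame s s' ∧
      IsLayering M c (i + 1) (fun v => s'.arr 1 v) ∧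
      (∀ v : Fin n, v ∈ s'.query ↔ s'.arr 1 v = i + 1) ∧
      (s'.query.Nonempty ↔ 1 ≤ s'.reg 6) := by
  obtain ⟨σ, hσ, hmono⟩ := hsort
  refine ((runs_clear h0).seq (B' := 2 + (n + 2) * (24 + 1 + 8)) ?_).mono ?_ fun _ => id
  · rintro _ rfl
    refine (Runs.of_wp (p := .set 6 (.lit 0)) (Q := fun s₁ => s₁ = { s with
      reg := Function.update (Function.update s.reg 2 n) 6 0, query := ∅ }) (by simp [wp, NExp.eval])).seq ?_
    rintro _ rfl
    refine (Runs.forBelow (N := n) (c := 24) (LayerInv M c σ i s) ?_ ?_ ?_).mono le_rfl ?_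
    · have hne : ∀ v : Fin n, s.arr 1 v ≠ i + 1 := fun v => by
        have : s.arr 1 v ≤ i := hL.le v
        omega
      simp [LayerInv, LayerFrame, hne]
      refine ⟨fun v => (hL.le v).trans (by omega), fun j hj hj' => ?_, fun v hv j hj hj' => ?_⟩
      · rcases hj'.lt_or_eq with h | rfl
        · exact hL.indep j hj (by omega)
        · simp [hne]
      · exact hL.spanned v hv j hj hj'
    · rintro p s' ⟨⟨e0, -⟩, h2, -⟩
      exact ⟨h2, by simpa [NExp.eval, h0] using e0⟩
    · intro p hp s' hs'
      exact runs_layerStep hM hO hσ hmono h5 hp hs'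
    · rintro s' ⟨hf, h2, h6, h6', hq, hle, hlt, hI, hsp⟩
      exact ⟨hf, ⟨hle, hI, fun v hv j hj hj' => hsp v hv j hj (by
        rcases hj'.lt_or_eq with h | h
        · left; omega
        · exact Or.inr ⟨h, (σ.symm v).2⟩)⟩, hq, h6, h6'⟩
  · simp; omega

end Phases

/-! ### Building all `⌈μ / ε⌉₊` layers. -/

section LayersPhase

variable {n : ℕ} {O : Oracles n}

open Algo

/-- The machine cannot divide, so it adds `ε` once per layer until the sum reaches `μ`; the first
such number of layers is exactly `⌈μ / ε⌉₊`. -/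
theorem runs_layers {M : Matroid (Fin n)} (hM : M.E = Set.univ) (hO : ∀ S, O.indep S ↔ M.Indep S)
    {c : Fin n → ℝ} {μ : ℕ} {ε : ℝ} (hμ : 1 ≤ μ) (hε : 0 < ε) {s : State n} (hin : Input μ ε s)
    (h5 : s.reg 5 = 1) (hsort : IsSorting c (s.arr 0)) (hL : IsLayering M c 1 fun v => s.arr 1 v) :
    Runs O layers s (100 * (n + 2) * (⌈μ / ε⌉₊ + μ + 2)) fun s' => s'.reg 0 = n ∧
      IsLayering M c ⌈μ / ε⌉₊ (fun v => s'.arr 1 v) := by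
  set ρ := ⌈μ / ε⌉₊ with hρ
  have hρ1 : 1 ≤ ρ := Nat.one_le_ceil_iff.2 (by positivity)
  obtain ⟨e0, e1, e2⟩ := hin
  have hinit : Runs O (.rset 3 (.sub .one .one)) s 4 fun s' =>
      s' = { s with rreg := Function.update s.rreg 3 0 } :=
    (Runs.of_wp (by simp [wp, RExp.eval])).mono (by decide) fun _ => id
  refine (hinit.seq (B' := (μ + 2) * (4 + 1 + 8) + (2 + ((ρ - 1) * (4 + (4 + (60 * (n + 2) + 4))) + 4)))
    ?_).mono ?_ fun _ => id
  swap
  · have key : ∀ r m X : ℕ, 2 ≤ X → 4 + ((m + 2) * (4 + 1 + 8) +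
        (2 + ((r - 1) * (4 + (4 + (60 * X + 4))) + 4))) ≤ 100 * X * (r + m + 2) := by
      intro r m X hX
      have h1 : (r - 1) * (4 + (4 + (60 * X + 4))) ≤ r * (12 + 60 * X) :=
        Nat.mul_le_mul (Nat.sub_le _ _) (by omega)
      have h2 := Nat.mul_le_mul_right m hX
      have h3 := Nat.mul_le_mul_right r hX
      calc _ ≤ 4 + ((m + 2) * (4 + 1 + 8) + (2 + (r * (12 + 60 * X) + 4))) := by omega
        _ ≤ _ := by nlinarith
    exact key ρ μ (n + 2) (by omega)
  rintro _ rfl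
  refine (Runs.forBelow (N := μ) (c := 4) (fun i s' => s'.reg 0 = n ∧ s'.reg 1 = μ ∧ s'.reg 2 = i ∧
    s'.reg 5 = 1 ∧ s'.rreg 0 = ε ∧ s'.rreg 3 = i ∧ s'.arr = s.arr) ?_ ?_ ?_).seq ?_
  · simp [e0, e1, e2, h5]
  · rintro i s' ⟨-, h1, h2, -⟩
    exact ⟨h2, h1⟩
  · rintro i hi s' ⟨a0, a1, a2, a5, b0, b3, ha⟩
    refine (Runs.of_wp (p := .rset 3 (.add (.var 3) .one)) ?_).mono (by decide) fun _ => id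
    simp [wp, RExp.eval, a0, a1, a2, a5, b0, b3, ha]
  rintro s₁ ⟨a0, a1, a2, a5, b0, b3, ha⟩
  refine (Runs.of_wp (p := .rset 4 (.var 0)) (Q := fun s' => s'.reg 0 = n ∧ s'.reg 5 = 1 ∧
    s'.rreg 0 = ε ∧ s'.rreg 3 = μ ∧ s'.rreg 4 = ε ∧ s'.arr = s.arr) ?_).seq ?_
  · simp [wp, RExp.eval, a0, a5, b0, b3, ha]
  rintro s₂ ⟨a0, a5, b0, b3, b4, ha⟩
  -- One layer exists on entry, hence `ρ - 1` rounds, and after `i` of them real register `4` holds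
  -- `(i + 1) * ε`.
  refine (Runs.loop (N := ρ - 1) (c := 4 + (60 * (n + 2) + 4)) (fun i s' => s'.reg 0 = n ∧
    s'.reg 5 = i + 1 ∧ s'.rreg 0 = ε ∧ s'.rreg 3 = μ ∧ s'.rreg 4 = (i + 1 : ℕ) * ε ∧
    s'.arr 0 = s.arr 0 ∧ IsLayering M c (i + 1) fun v => s'.arr 1 v) ?_ ?_ ?_).mono ?_ ?_
  · rintro i hi s₃ ⟨a0, a5, b0, b3, b4, ha, hL⟩
    constructor
    · simp only [Test.Holds, RExp.eval, b3, b4, not_le]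
      have : i + 1 < ρ := by omega
      rwa [hρ, Nat.lt_ceil, lt_div_iff₀ hε] at this
    · refine (Runs.of_wp (p := .incr 5) (Q := fun s' => s'.reg 0 = n ∧ s'.reg 5 = i + 1 + 1 ∧
        s'.rreg = s₃.rreg ∧ s'.arr = s₃.arr) ?_).seq ?_
      · simp [wp, Prog.incr, NExp.eval, a0, a5]
      rintro s₄ ⟨c0, c5, cr, ca⟩
      refine (runs_layer hM hO c0 c5 (c := c) (by rw [ca, ha]; exact hsort) (by rw [ca]; exact hL)).seq ?_
      rintro s₅ ⟨⟨f0, f1, f5, fr, fa⟩, hL', -⟩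
      refine (Runs.of_wp (p := .rset 4 (.add (.var 4) (.var 0))) ?_).mono (by decide) fun _ => id
      simp only [wp, RExp.eval, fr, cr, b0, b4, f0, c0, f5, c5, fa, ca, ha, hL', Function.update_self,
        true_and, and_true]
      simp [b0, b3]
      ring
  · rintro s' ⟨-, -, -, b3, b4, -⟩
    simp only [Test.Holds, RExp.eval, b3, b4, not_not]
    have : ρ - 1 + 1 = ρ := by omega
    rw [this, ← div_le_iff₀ hε]
    exact Nat.le_ceil _
  · simpa [a0, a5, b0, b3, b4, ha] using hL
  · exact le_rfl
  · rintro s' ⟨h0, -, -, -, -, -, h⟩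
    have : ρ - 1 + 1 = ρ := by omega
    rw [this] at h
    exact ⟨h0, h⟩

end LayersPhase

/-! ### The search -/

section Search

variable {n : ℕ} {O : Oracles n}

open Algo

/-- Whatever the loop does from `s'`, it does from `s` with at most `T` more steps. -/
def LoopReaches (O : Oracles n) (b : Test) (p : Prog) (s : State n) (T : ℕ) (s' : State n) : Prop :=
  ∀ B Q, Runs O (.loop b p) s' B Q → Runs O (.loop b p) s (B + T) Q

theorem LoopReaches.refl {b : Test} {p : Prog} (s : State n) : LoopReaches O b p s 0 s :=
  fun _ _ h => h

theorem LoopReaches.trans {b : Test} {p : Prog} {s s' s'' : State n} {T T' : ℕ}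
    (h : LoopReaches O b p s T s') (h' : LoopReaches O b p s' T' s'') :
    LoopReaches O b p s (T + T') s'' := fun B Q hr =>
  (h _ _ (h' _ _ hr)).mono (by omega) fun _ => id

theorem LoopReaches.mono {b : Test} {p : Prog} {s s' : State n} {T T' : ℕ}
    (h : LoopReaches O b p s T s') (hT : T ≤ T') : LoopReaches O b p s T' s' := fun B Q hr =>
  (h _ _ hr).mono (by omega) fun _ => id

theorem Runs.loopReaches {b : Test} {p : Prog} {s : State n} {c : ℕ} {P : State n → Prop}
    (h : Runs O p s c P) (hb : b.Holds O s) :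
    ∃ s', P s' ∧ LoopReaches O b p s (b.cost + c) s' := by
  obtain ⟨t, s', he, ht, hP⟩ := h
  refine ⟨s', hP, ?_⟩
  rintro B Q ⟨t', s'', he', ht', hQ⟩
  exact ⟨_, s'', Exec.loop_true hb he he', by omega, hQ⟩

/-- Configuration of the search: position `p`, stack `l`. -/
def SearchAt (L : Fin n → ℕ) (p : ℕ) (l : List (Fin n)) (s : State n) : Prop :=
  s.reg 0 = n ∧ s.reg 2 = p ∧ s.reg 3 = l.length ∧ s.reg 4 = 1 ∧
    (∀ j (h : j < l.length), s.arr 2 j = l[j]) ∧ s.query = l.toFinset ∧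
    ∀ v : Fin n, s.arr 1 v = L v

/-- Array `3` holds an independent set whose value is in real register `1`. -/
def HasBest (O : Oracles n) (s : State n) : Prop :=
  ∃ B : List (Fin n), B.length ≤ n ∧ s.reg 6 = B.length ∧ (∀ j (h : j < B.length), s.arr 3 j = B[j]) ∧
    s.rreg 1 = O.value B.toFinset ∧ O.indep B.toFinset

theorem runs_evaluate {L : Fin n → ℕ} {p : ℕ} {l : List (Fin n)} {s : State n} (hn : l.Nodup)
    (hs : SearchAt L p l s) (hb : HasBest O s) (hl : O.indep l.toFinset) :
    Runs O evaluate s (20 * (n + 2)) fun s' => SearchAt L p l s' ∧ HasBest O s' ∧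
      s.rreg 1 ≤ s'.rreg 1 ∧ O.value l.toFinset ≤ s'.rreg 1 := by
  have hlen : l.length ≤ n := by simpa using hn.length_le_card
  obtain ⟨h0, h2, h3, h4, hst, hq, hL⟩ := hs
  refine ((Runs.of_wp (p := .value 2) (Q := fun s' => s' = { s with
    rreg := Function.update s.rreg 2 (O.value l.toFinset) }) (by simp [wp, hq])).seq
    (B' := 3 + (4 + (n + 2) * (13 + 3))) ?_).mono ?_ fun _ => id
  swap
  · simp only [Prog.maxCost]; omega
  rintro _ rfl
  refine Runs.ite ?_ ?_
  · intro hle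
    simp only [Test.Holds, RExp.eval, Function.update_self, Function.update_of_ne, ne_eq,
      OfNat.one_ne_ofNat, not_false_eq_true] at hle
    refine (Runs.of_wp (p := .skip) ?_).mono (by simp [Prog.maxCost]; omega) fun _ => id
    obtain ⟨B, hBn, hB6, hB, hBv, hBi⟩ := hb
    simp only [wp]
    refine ⟨⟨h0, h2, h3, h4, hst, hq, hL⟩, ⟨B, hBn, hB6, hB, by simpa using hBv, hBi⟩, by simp, by simpa using hle⟩
  · intro hlt
    simp only [Test.Holds, RExp.eval, Function.update_self, Function.update_of_ne, ne_eq,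
      OfNat.one_ne_ofNat, not_false_eq_true, not_le] at hlt
    refine ((Runs.of_wp (p := .rset 1 (.var 2)) (Q := fun s' => SearchAt L p l s' ∧
      s'.rreg 1 = O.value l.toFinset) ?_).seq (B' := 2 + (l.length + 2) * (5 + 1 + 8)) ?_).mono ?_ fun _ => id
    · simpa [wp, RExp.eval, SearchAt, h0, h2, h3, h4, hq, hL] using hst
    · rintro s₁ ⟨⟨h0, h2, h3, h4, hst, hq, hL⟩, hr⟩
      refine (Runs.of_wp (p := .set 6 (.var 3)) (Q := fun s' => SearchAt L p l s' ∧
        s'.rreg 1 = O.value l.toFinset ∧ s'.reg 6 = l.length) ?_).seq ?_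
      · simpa [wp, NExp.eval, SearchAt, h0, h2, h3, h4, hq, hL, hr] using hst
      rintro s₂ ⟨⟨h0, h2, h3, h4, hst, hq, hL⟩, hr, h6⟩
      refine (Runs.forBelow (N := l.length) (c := 5) (fun i s' => SearchAt L p l s' ∧
        s'.rreg 1 = O.value l.toFinset ∧ s'.reg 6 = l.length ∧ s'.reg 7 = i ∧
        ∀ j (h : j < l.length), j < i → s'.arr 3 j = l[j]) ?_ ?_ ?_).mono le_rfl ?_
      · simpa [SearchAt, h0, h2, h3, h4, hq, hL, hr, h6] using hst
      · rintro i s' ⟨⟨-, -, h3, -⟩, -, -, h7, -⟩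
        exact ⟨h7, h3⟩
      · rintro i hi s' ⟨⟨h0, h2, h3, h4, hst, hq, hL⟩, hr, h6, h7, ha⟩
        refine (Runs.of_wp (p := .store 3 (.var 7) (.read 2 (.var 7))) ?_).mono (by decide) fun _ => id
        simp [wp, NExp.eval, SearchAt, h0, h2, h3, h4, hq, hL, hr, h6, h7]
        refine ⟨hst, fun j hj hji => ?_⟩
        rw [Function.update_apply]
        split_ifs with h
        · subst h; exact hst j hj
        · exact ha j hj (by omega)
      · rintro s' ⟨hs', hr, h6, h7, ha⟩
        exact ⟨hs', ⟨l, hlen, h6, fun j hj => ha j hj hj, hr, hl⟩, by rw [hr]; exact hlt.le, hr.ge⟩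
    · simp [Prog.maxCost, RExp.cost]; nlinarith

theorem runs_leaf_concat {L : Fin n → ℕ} {p : ℕ} {l : List (Fin n)} {v : Fin n} {s : State n}
    (hn : (l ++ [v]).Nodup) (hs : SearchAt L p (l ++ [v]) s) (hb : HasBest O s)
    (hl : O.indep (l ++ [v]).toFinset) :
    Runs O leaf s (20 * (n + 2) + 20) fun s' => SearchAt L (v + 1) l s' ∧ HasBest O s' ∧
      s.rreg 1 ≤ s'.rreg 1 ∧ O.value (l ++ [v]).toFinset ≤ s'.rreg 1 := by
  refine (runs_evaluate hn hs hb hl).seq ?_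
  rintro s₁ ⟨⟨h0, h2, h3, h4, hst, hq, hL⟩, ⟨B, hBn, hB6, hB, hBv, hBi⟩, hle, hle'⟩
  refine (Runs.of_wp (p := backtrack) ?_).mono (by decide) fun _ => id
  have hv : v ∉ l := fun h => by
    rw [List.nodup_append] at hn; exact hn.2.2 v h v (by simp) rfl
  have hlast : s₁.arr 2 l.length = v := by
    rw [hst l.length (by simp)]; simp
  have hst' : ∀ j (h : j < l.length), s₁.arr 2 j = l[j] := fun j h => by
    rw [hst j (by simp; omega), List.getElem_append_left h]
  have hq' : s₁.query.erase v = l.toFinset := by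
    rw [hq]; ext x; simp only [Finset.mem_erase, List.mem_toFinset, List.mem_append, List.mem_singleton]
    constructor
    · rintro ⟨h, h' | h'⟩
      · exact h'
      · exact absurd h' h
    · intro h; exact ⟨fun h' => hv (h' ▸ h), Or.inl h⟩
  simp [wp, backtrack, Prog.incr, Test.Holds, NExp.eval, SearchAt, HasBest, h0, h2, h3, h4, hlast, hq',
    hL, hle]
  exact ⟨hst', ⟨B, hBn, hB6, hB, hBv, hBi⟩, by simpa using hle'⟩

theorem runs_leaf_nil {L : Fin n → ℕ} {p : ℕ} {s : State n}
    (hs : SearchAt L p [] s) (hb : HasBest O s) (hl : O.indep ∅) :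
    Runs O leaf s (20 * (n + 2) + 20) fun s' => s'.reg 4 = 0 ∧ s'.query = ∅ ∧ HasBest O s' ∧
      s.rreg 1 ≤ s'.rreg 1 ∧ O.value ∅ ≤ s'.rreg 1 := by
  refine (runs_evaluate (by simp) hs hb (by simpa using hl)).seq ?_
  rintro s₁ ⟨⟨h0, h2, h3, h4, hst, hq, hL⟩, ⟨B, hBn, hB6, hB, hBv, hBi⟩, hle, hle'⟩
  refine (Runs.of_wp (p := backtrack) ?_).mono (by decide) fun _ => id
  simp [wp, backtrack, Prog.incr, Test.Holds, NExp.eval, HasBest, h3, hq, hle]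
  exact ⟨⟨B, hBn, hB6, hB, hBv, hBi⟩, by simpa using hle'⟩

theorem runs_descend {L : Fin n → ℕ} {l : List (Fin n)} {v : Fin n} {s : State n}
    (hv : v ∉ l) (hs : SearchAt L v l s) (hb : HasBest O s) :
    Runs O descend s 30 fun s' => HasBest O s' ∧ s'.rreg 1 = s.rreg 1 ∧
      ((L v ≠ 0 ∧ O.indep (insert v l.toFinset)) → SearchAt L (v + 1) (l ++ [v]) s') ∧
      (¬ (L v ≠ 0 ∧ O.indep (insert v l.toFinset)) → SearchAt L (v + 1) l s') := by
  obtain ⟨h0, h2, h3, h4, hst, hq, hL⟩ := hs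
  obtain ⟨B, hBn, hB6, hB, hBv, hBi⟩ := hb
  refine (Runs.of_wp (p := descend) ?_).mono (by decide) fun _ => id
  simp only [wp, descend, Prog.incr, Test.Holds, NExp.eval, h2, h3, hL, hq, v.2, dif_pos,
    Function.update_of_ne, ne_eq, Nat.reduceEqDiff, not_false_eq_true, Fin.eta]
  refine ⟨fun h => ⟨fun hi => ?_, fun hi => ?_⟩, fun h => ?_⟩
  · have hv0 : L v ≠ 0 := by omega
    refine ⟨⟨B, hBn, by simpa using hB6, by simpa using hB, hBv, hBi⟩, trivial, fun _ => ?_,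
      fun hc => absurd ⟨hv0, hi⟩ hc⟩
    simp [SearchAt, h0, h4, hL]
    intro j hj
    rw [Function.update_apply]
    split_ifs with hjl
    · subst hjl; simp
    · rw [hst j (by omega), List.getElem_append_left]
  · have herase : (insert v l.toFinset).erase v = l.toFinset :=
      Finset.erase_insert (by simpa using hv)
    refine ⟨⟨B, hBn, by simpa using hB6, by simpa using hB, hBv, hBi⟩, trivial, fun hc => absurd hc.2 hi,
      fun _ => ?_⟩
    simp only [herase]
    simpa [SearchAt, h0, h2, h3, h4, hL] using hst
  · have hv0 : L v = 0 := by omega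
    refine ⟨⟨B, hBn, by simpa using hB6, by simpa using hB, hBv, hBi⟩, trivial, fun hc => absurd hv0 hc.1,
      fun _ => ?_⟩
    simpa [SearchAt, h0, h2, h3, h4, hL, hq] using hst

end Search

/-! ### The search tree and the number of its branches. -/

section Exploration

variable {n : ℕ} {O : Oracles n}

open Algo

open Classical in
/-- The sets that the search from position `p` adds to the set `S`. -/
noncomputable def extensions (M : Matroid (Fin n)) (L : Fin n → ℕ) (p : ℕ) (S : Finset (Fin n)) :
    Finset (Finset (Fin n)) :=
  Finset.univ.filter fun J => (∀ v ∈ J, p ≤ v.1 ∧ L v ≠ 0) ∧ M.Indep ((S ∪ J : Finset (Fin n)) : Set (Fin n))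

theorem mem_extensions {M : Matroid (Fin n)} {L : Fin n → ℕ} {p : ℕ} {S J : Finset (Fin n)} :
    J ∈ extensions M L p S ↔
      (∀ v ∈ J, p ≤ v.1 ∧ L v ≠ 0) ∧ M.Indep ((S ∪ J : Finset (Fin n)) : Set (Fin n)) := by
  simp [extensions]

theorem extensions_subset (M : Matroid (Fin n)) (L : Fin n → ℕ) (p : ℕ) (S : Finset (Fin n)) :
    extensions M L (p + 1) S ⊆ extensions M L p S := by
  intro J hJ
  rw [mem_extensions] at hJ ⊢
  exact ⟨fun v hv => ⟨by have := (hJ.1 v hv).1; omega, (hJ.1 v hv).2⟩, hJ.2⟩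

theorem card_extensions_pos {M : Matroid (Fin n)} {S : Finset (Fin n)}
    (hS : M.Indep (S : Set (Fin n))) (L : Fin n → ℕ) (p : ℕ) : 1 ≤ (extensions M L p S).card :=
  Finset.card_pos.2 ⟨∅, mem_extensions.2 ⟨by simp, by simpa using hS⟩⟩

/-- The extensions split into those that contain `v` and those that do not. This is the recurrence
behind the running time of the search. -/
theorem card_extensions_add_le {M : Matroid (Fin n)} {L : Fin n → ℕ} {v : Fin n}
    (hv : L v ≠ 0) (S : Finset (Fin n)) :
    (extensions M L (v + 1) (insert v S)).card + (extensions M L (v + 1) S).card ≤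
      (extensions M L v S).card := by
  classical
  have hnot : ∀ S, ∀ J ∈ extensions M L (v + 1) S, v ∉ J := fun S J hJ h => by
    have := ((mem_extensions.1 hJ).1 v h).1
    omega
  have hinj : Set.InjOn (insert v) (extensions M L (v + 1) (insert v S) : Set (Finset (Fin n))) := by
    intro J hJ J' hJ' h
    rw [← Finset.erase_insert (hnot _ J hJ), ← Finset.erase_insert (hnot _ J' hJ'), h]
  rw [← Finset.card_image_of_injOn hinj, ← Finset.card_union_of_disjoint]
  · refine Finset.card_le_card (Finset.union_subset ?_ (extensions_subset _ _ _ _))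
    intro J' hJ'
    obtain ⟨J, hJ, rfl⟩ := Finset.mem_image.1 hJ'
    rw [mem_extensions] at hJ ⊢
    refine ⟨fun x hx => ?_, ?_⟩
    · rcases Finset.mem_insert.1 hx with rfl | hx
      · exact ⟨le_rfl, hv⟩
      · exact ⟨by have := (hJ.1 x hx).1; omega, (hJ.1 x hx).2⟩
    · convert hJ.2 using 2
      rw [Finset.union_insert, Finset.insert_union]
  · rw [Finset.disjoint_left]
    intro J' hJ' hJ''
    obtain ⟨J, hJ, rfl⟩ := Finset.mem_image.1 hJ'
    exact hnot _ _ hJ'' (Finset.mem_insert_self _ _)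

theorem Runs.searchStep_descend {s : State n} {B : ℕ} {Q : State n → Prop} (h : s.reg 2 < s.reg 0)
    (hr : Runs O descend s B Q) : Runs O searchStep s (5 + B) Q :=
  Runs.ite (fun _ => hr) fun h' => absurd h h'

theorem Runs.searchStep_leaf {s : State n} {B : ℕ} {Q : State n → Prop} (h : ¬ s.reg 2 < s.reg 0)
    (hr : Runs O leaf s B Q) : Runs O searchStep s (5 + B) Q :=
  Runs.ite (fun h' => absurd h' h) fun _ => hr

/-- The flat loop simulates a recursion on the `d` positions left. It ends just before the set on
the stack `l` is itself evaluated, which is why only nonempty `J` are covered. With `c = 50 * (n +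
2)` bounding one loop round, a node costs at most two rounds (descend, leaf) besides its branches.
The bound `2 * d * N * c` is inductive because the branch counts add up to at most `N` and `N ≥ 1`.
-/
theorem exists_loopReaches_search {M : Matroid (Fin n)} (hO : ∀ S, O.indep S ↔ M.Indep S)
    (L : Fin n → ℕ) (d : ℕ) : ∀ (p : ℕ) (l : List (Fin n)) (s : State n), p + d = n → l.Nodup →
    (∀ v ∈ l, v.1 < p) → M.Indep (l.toFinset : Set (Fin n)) → SearchAt L p l s → HasBest O s →
    ∃ s', LoopReaches O (.le (.lit 1) (.var 4)) searchStep s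
        (2 * d * (extensions M L p l.toFinset).card * (50 * (n + 2))) s' ∧
      SearchAt L n l s' ∧ HasBest O s' ∧ s.rreg 1 ≤ s'.rreg 1 ∧
      ∀ J ∈ extensions M L p l.toFinset, J.Nonempty → O.value (l.toFinset ∪ J) ≤ s'.rreg 1 := by
  induction d with
  | zero =>
    intro p l s hp _ _ _ hs hb
    obtain rfl : p = n := by omega
    refine ⟨s, by simpa using LoopReaches.refl s, hs, hb, le_rfl, ?_⟩
    rintro J hJ ⟨v, hv⟩
    have := ((mem_extensions.1 hJ).1 v hv).1
    omega
  | succ d ih =>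
    intro p l s hp hn hlt hI hs hb
    have hpn : p < n := by omega
    obtain ⟨v, rfl⟩ : ∃ v : Fin n, v.1 = p := ⟨⟨p, hpn⟩, rfl⟩
    have hvl : v ∉ l := fun h => absurd (hlt v h) (lt_irrefl _)
    have hstep := (runs_descend hvl hs hb).searchStep_descend (by rw [hs.1, hs.2.1]; exact hpn)
    have hflag : ∀ {p l s}, SearchAt L p l s → (Test.le (.lit 1) (.var 4)).Holds O s := by
      rintro p l s ⟨-, -, -, h4, -⟩
      simp [Test.Holds, NExp.eval, h4]
    obtain ⟨s₁, ⟨hb₁, hr₁, hyes, hno⟩, hreach⟩ := hstep.loopReaches (b := .le (.lit 1) (.var 4)) (hflag hs)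
    have hlt' : ∀ x ∈ l, x.1 < v.1 + 1 := fun x hx => (hlt x hx).trans (by omega)
    have hpos := card_extensions_pos hI L (v.1 + 1)
    by_cases hc : L v ≠ 0 ∧ O.indep (insert v l.toFinset)
    · have hins : (l ++ [v]).toFinset = insert v l.toFinset := by ext; simp
      have hn' : (l ++ [v]).Nodup := by
        rw [List.nodup_append]
        refine ⟨hn, by simp, ?_⟩
        intro a ha b hb' hab
        rw [List.mem_singleton] at hb'
        exact hvl (by rw [← hb', ← hab]; exact ha)
      have hI' : M.Indep ((l ++ [v]).toFinset : Set (Fin n)) := by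
        rw [hins]; exact (hO _).1 hc.2
      obtain ⟨s₂, hreach₂, hs₂, hb₂, hle₂, hJ₂⟩ := ih (v + 1) (l ++ [v]) s₁ (by omega) hn' (by
          intro x hx
          rcases List.mem_append.1 hx with hx | hx
          · exact hlt' x hx
          · rw [List.mem_singleton.1 hx]; omega) hI' (hyes hc) hb₁
      have hleaf := (runs_leaf_concat hn' hs₂ hb₂ ((hO _).2 hI')).searchStep_leaf
        (by rw [hs₂.1, hs₂.2.1]; exact lt_irrefl n)
      obtain ⟨s₃, ⟨hs₃, hb₃, hle₃, hval₃⟩, hreach₃⟩ :=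
        hleaf.loopReaches (b := .le (.lit 1) (.var 4)) (hflag hs₂)
      obtain ⟨s₄, hreach₄, hs₄, hb₄, hle₄, hJ₄⟩ := ih (v + 1) l s₃ (by omega) hn hlt' hI hs₃ hb₃
      refine ⟨s₄, (((hreach.trans hreach₂).trans hreach₃).trans hreach₄).mono ?_, hs₄, hb₄,
        by linarith, ?_⟩
      · have hcard := card_extensions_add_le (M := M) hc.1 l.toFinset
        rw [hins]
        simp only [Test.cost, NExp.cost]
        generalize (extensions M L (v + 1) (insert v l.toFinset)).card = N₁ at *
        generalize (extensions M L (v + 1) l.toFinset).card = N₂ at *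
        generalize (extensions M L v l.toFinset).card = N at *
        obtain ⟨c, hc'⟩ : ∃ c, c = 50 * (n + 2) := ⟨_, rfl⟩
        rw [← hc']
        have h1 : 2 * (d + 1) * (N₁ + N₂) * c ≤ 2 * (d + 1) * N * c := by gcongr
        have h2 : c * 1 ≤ c * (N₁ + N₂) := Nat.mul_le_mul_left _ (by omega)
        refine le_trans ?_ h1
        calc _ ≤ 2 * d * N₁ * c + 2 * d * N₂ * c + 2 * c := by omega
          _ ≤ 2 * d * N₁ * c + 2 * d * N₂ * c + 2 * (c * (N₁ + N₂)) := by omega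
          _ = _ := by ring
      · intro J hJ hne
        rw [mem_extensions] at hJ
        by_cases hvJ : v ∈ J
        · have hJe : insert v l.toFinset ∪ J.erase v = l.toFinset ∪ J := by
            ext x; simp only [Finset.mem_union, Finset.mem_insert, Finset.mem_erase]
            by_cases hx : x = v
            · subst hx; simp [hvJ]
            · simp [hx]
          -- If `J = {v}`, its value was compared at the leaf that popped `v`; otherwise the branch
          -- containing `v` has treated it.
          by_cases he : (J.erase v).Nonempty
          · have := hJ₂ (J.erase v) (mem_extensions.2 ⟨fun x hx => ⟨?_, ?_⟩, ?_⟩) he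
            · rw [hins, hJe] at this
              linarith
            · have h1 := (hJ.1 x (Finset.mem_of_mem_erase hx)).1
              have h2 : x.1 ≠ v.1 := fun h => Finset.ne_of_mem_erase hx (Fin.ext h)
              omega
            · exact (hJ.1 x (Finset.mem_of_mem_erase hx)).2
            · rw [hins, hJe]; exact hJ.2
          · rw [Finset.not_nonempty_iff_eq_empty] at he
            rw [he, Finset.union_empty, ← hins] at hJe
            rw [← hJe]
            linarith
        · refine hJ₄ J (mem_extensions.2 ⟨fun x hx => ⟨?_, (hJ.1 x hx).2⟩, hJ.2⟩) hne
          have h1 := (hJ.1 x hx).1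
          have h2 : x.1 ≠ v.1 := fun h => hvJ (Fin.ext h ▸ hx)
          omega
    · obtain ⟨s₂, hreach₂, hs₂, hb₂, hle₂, hJ₂⟩ := ih (v + 1) l s₁ (by omega) hn hlt' hI (hno hc) hb₁
      refine ⟨s₂, (hreach.trans hreach₂).mono ?_, hs₂, hb₂, by linarith, ?_⟩
      · have hcard := Finset.card_le_card (extensions_subset M L v l.toFinset)
        simp only [Test.cost, NExp.cost]
        generalize (extensions M L (v + 1) l.toFinset).card = N₂ at *
        generalize (extensions M L v l.toFinset).card = N at *
        obtain ⟨c, hc'⟩ : ∃ c, c = 50 * (n + 2) := ⟨_, rfl⟩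
        rw [← hc']
        have h1 : 2 * (d + 1) * N₂ * c ≤ 2 * (d + 1) * N * c := by gcongr
        have h2 : c * 1 ≤ c * N₂ := Nat.mul_le_mul_left _ (by omega)
        refine le_trans ?_ h1
        calc _ ≤ 2 * d * N₂ * c + 2 * c := by omega
          _ ≤ 2 * d * N₂ * c + 2 * (c * N₂) := by omega
          _ = _ := by ring
      · intro J hJ hne
        rw [mem_extensions] at hJ
        refine hJ₂ J (mem_extensions.2 ⟨fun x hx => ⟨?_, (hJ.1 x hx).2⟩, hJ.2⟩) hne
        have h1 := (hJ.1 x hx).1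
        -- No extension contains a rejected `v`: its label would be nonzero and, by heredity, the
        -- stack with `v` added would be independent.
        have h2 : x.1 ≠ v.1 := fun h => by
          have hxv : x = v := Fin.ext h
          subst hxv
          refine hc ⟨(hJ.1 x hx).2, (hO _).2 (hJ.2.subset ?_)⟩
          rw [Finset.coe_insert, Set.insert_subset_iff]
          exact ⟨by simp [hx], by simp⟩
        omega

theorem runs_search {M : Matroid (Fin n)} (hO : ∀ S, O.indep S ↔ M.Indep S)
    (hval : O.value ∅ = 0) {s : State n} (h0 : s.reg 0 = n) :
    Runs O search s (200 * (n + 2) * (n + 2) * (extensions M (fun v => s.arr 1 v) 0 ∅).card)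
      fun s' => M.Indep (s'.query : Set (Fin n)) ∧ ∀ J : Finset (Fin n),
        (∀ v ∈ J, s.arr 1 v ≠ 0) → M.Indep (J : Set (Fin n)) → O.value J ≤ O.value s'.query := by
  set L : Fin n → ℕ := fun v => s.arr 1 v with hL
  set N := (extensions M L 0 ∅).card with hN
  have hN1 : 1 ≤ N := card_extensions_pos (by simp) L 0
  refine ((runs_clear h0).seq (B' := 12 + ((3 + 2 * n * N * (50 * (n + 2)) + (3 + (5 + (20 * (n + 2) + 20)))) +
    (n + 2) * (3 + 1 + 8))) ?_).mono ?_ fun _ => id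
  swap
  · have h1 : (n + 2) * 1 ≤ (n + 2) * N := Nat.mul_le_mul_left _ hN1
    nlinarith
  rintro _ rfl
  refine ((Runs.of_wp (p := searchInit) (Q := fun s' => SearchAt L 0 [] s' ∧ HasBest O s') ?_).mono
    (by decide) fun _ => id).seq ?_
  · simp [wp, searchInit, NExp.eval, RExp.eval, SearchAt, HasBest, h0, hL]
    exact ⟨[], by simp [hval, hO]⟩
  rintro s₁ ⟨hs₁, hb₁⟩
  obtain ⟨s₂, hreach, hs₂, hb₂, hle, hJ⟩ := exists_loopReaches_search hO L n 0 [] s₁ (by omega)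
    (by simp) (by simp) (by simp) hs₁ hb₁
  have hflag : (Test.le (.lit 1) (.var 4)).Holds O s₂ := by
    obtain ⟨-, -, -, h4, -⟩ := hs₂
    simp [Test.Holds, NExp.eval, h4]
  have hleaf := (runs_leaf_nil hs₂ hb₂ ((hO _).2 (by simp))).searchStep_leaf
    (by rw [hs₂.1, hs₂.2.1]; exact lt_irrefl n)
  obtain ⟨s₃, ⟨h4, hq, hb₃, hle₃, hval₃⟩, hreach₃⟩ :=
    hleaf.loopReaches (b := .le (.lit 1) (.var 4)) hflag
  have hend : Runs O (.loop (.le (.lit 1) (.var 4)) searchStep) s₃ 3 fun s' => s' = s₃ :=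
    ⟨_, s₃, Exec.loop_false (by simp [Test.Holds, NExp.eval, h4]), le_rfl, rfl⟩
  have hloop := (hreach.trans hreach₃) _ _ hend
  refine (hloop.mono (B' := 3 + 2 * n * N * (50 * (n + 2)) + (3 + (5 + (20 * (n + 2) + 20)))) (by
    simp only [List.toFinset_nil, ← hN, Test.cost, NExp.cost]; omega) fun _ => id).seq ?_
  rintro s₄ rfl
  obtain ⟨B, hBn, hB6, hB, hBv, hBi⟩ := hb₃
  refine (Runs.forBelow (N := B.length) (c := 3) (fun i s' => s'.reg 6 = B.length ∧ s'.reg 7 = i ∧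
    s'.arr 3 = s₄.arr 3 ∧ s'.query = (B.take i).toFinset) ?_ ?_ ?_).mono ?_ ?_
  · simp [hB6, hq]
  · rintro i s' ⟨h6, h7, -⟩
    exact ⟨h7, h6⟩
  · rintro i hi s' ⟨h6, h7, ha, hq'⟩
    refine (Runs.of_wp (p := .insert (.read 3 (.var 7))) ?_).mono (by decide) fun _ => id
    simp [wp, NExp.eval, h6, h7, ha, hq', hB i hi]
    rw [← List.take_append_getElem hi]
    ext x
    rw [Finset.mem_insert, List.mem_toFinset, List.mem_toFinset, List.mem_append,
      List.mem_singleton, or_comm]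
  · simp only [NExp.cost]
    gcongr
  · rintro s' ⟨-, -, -, hq'⟩
    rw [List.take_length] at hq'
    rw [hq']
    refine ⟨(hO _).1 hBi, fun J hJL hJI => ?_⟩
    rw [← hBv]
    rcases J.eq_empty_or_nonempty with rfl | hne
    · exact hval₃
    · have := hJ J (mem_extensions.2 ⟨fun v hv => ⟨by omega, hJL v hv⟩, by simpa using hJI⟩) hne
      simp only [List.toFinset_nil, Finset.empty_union] at this
      exact this.trans hle₃

end Exploration

/-! ### Counting, time bounds and assembly. -/

section Main

variable {n : ℕ}

open Algo

theorem card_le_of_indep {V : Type*} {M : Matroid V} {k : ℕ} (hk : M.eRank = k)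
    {S : Finset V} (hS : M.Indep (S : Set V)) : S.card ≤ k := by
  have := hS.encard_le_eRank
  rw [hk, Set.encard_coe_eq_coe_finsetCard] at this
  exact_mod_cast this

/-- The number of independent sets of labelled elements. -/
theorem IsLayering.card_extensions_le {M : Matroid (Fin n)} {c : Fin n → ℝ} {ρ k : ℕ}
    {L : Fin n → ℕ} (hL : IsLayering M c ρ L) (hk : M.eRank = k) (hρ : 1 ≤ ρ) :
    ((extensions M L 0 ∅).card : ℝ) ≤ (3 * ρ) ^ k := by
  classical
  have hρ0 : (0 : ℝ) < ρ := by exact_mod_cast hρ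
  set W : Finset (Fin n) := Finset.univ.filter fun v => L v ≠ 0 with hW
  have hcard : W.card ≤ ρ * k := by
    have hsub : W ⊆ (Finset.Icc 1 ρ).biUnion fun j => Finset.univ.filter fun v => L v = j := by
      intro v hv
      have hv' := (Finset.mem_filter.1 hv).2
      simp only [Finset.mem_biUnion, Finset.mem_Icc, Finset.mem_filter, Finset.mem_univ, true_and]
      exact ⟨L v, ⟨by omega, hL.le v⟩, rfl⟩
    refine (Finset.card_le_card hsub).trans ?_
    have h := Finset.card_biUnion_le_card_mul (Finset.Icc 1 ρ)
      (fun j => Finset.univ.filter fun v => L v = j) k (by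
        intro j hj
        rw [Finset.mem_Icc] at hj
        refine card_le_of_indep hk ?_
        simpa using hL.indep j hj.1 hj.2)
    simpa using h
  -- Give each set `J` weight `(1/ρ)^|J|`, which is at least `(1/ρ)^k`. All subsets of the kernel
  -- together weigh `(1 + 1/ρ)^|W|`, and `|W| ≤ ρ * k` bounds this by `e^k`.
  have hsum : ((extensions M L 0 ∅).card : ℝ) * (1 / (ρ : ℝ)) ^ k ≤ Real.exp 1 ^ k := by
    have hx0 : (0 : ℝ) ≤ 1 / ρ := by positivity
    have hx1 : 1 / (ρ : ℝ) ≤ 1 := by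
      rw [div_le_one hρ0]; exact_mod_cast hρ
    calc ((extensions M L 0 ∅).card : ℝ) * (1 / (ρ : ℝ)) ^ k
        = ∑ _J ∈ extensions M L 0 ∅, (1 / (ρ : ℝ)) ^ k := by rw [Finset.sum_const, nsmul_eq_mul]
      _ ≤ ∑ J ∈ extensions M L 0 ∅, (1 / (ρ : ℝ)) ^ J.card := by
          refine Finset.sum_le_sum fun J hJ => pow_le_pow_of_le_one hx0 hx1 ?_
          have := (mem_extensions.1 hJ).2
          rw [Finset.empty_union] at this
          exact card_le_of_indep hk this
      _ ≤ ∑ J ∈ W.powerset, (1 / (ρ : ℝ)) ^ J.card := by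
          refine Finset.sum_le_sum_of_subset_of_nonneg ?_ fun _ _ _ => by positivity
          intro J hJ
          rw [Finset.mem_powerset]
          intro v hv
          simpa [hW] using ((mem_extensions.1 hJ).1 v hv).2
      _ = (1 / (ρ : ℝ) + 1) ^ W.card := by
          rw [← Finset.sum_pow_mul_eq_add_pow]; simp
      _ ≤ Real.exp (1 / ρ) ^ W.card := by
          gcongr; exact Real.add_one_le_exp _
      _ ≤ Real.exp (1 / ρ) ^ (ρ * k) := by
          gcongr; exact Real.one_le_exp hx0
      _ = Real.exp 1 ^ k := by
          rw [pow_mul, ← Real.exp_nat_mul]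
          congr 2; field_simp
  rw [one_div, inv_pow, ← div_eq_mul_inv, div_le_iff₀ (by positivity), ← mul_pow] at hsum
  refine hsum.trans ?_
  gcongr
  exact Real.exp_one_lt_three.le

theorem early_time_le {C n μ k : ℕ} {ε : ℝ} (hC : 4000 ≤ C) (hn : 1 ≤ n) (hμ : 1 ≤ μ) (hε : 0 < ε)
    (hε1 : ε ≤ 1) :
    (60 * (n + 2) * (n + 2) + (60 * (n + 2)) + 20 : ℝ) ≤ C * (μ / ε) ^ (C * k) * (n : ℝ) ^ C := by
  have hn' : (1 : ℝ) ≤ n := by exact_mod_cast hn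
  have hμ' : (1 : ℝ) ≤ μ := by exact_mod_cast hμ
  have hC' : (4000 : ℝ) ≤ C := by exact_mod_cast hC
  have h1 : 1 ≤ (μ / ε) ^ (C * k) := one_le_pow₀ ((one_le_div hε).2 (hε1.trans hμ'))
  have h2 : (n : ℝ) ^ 2 ≤ (n : ℝ) ^ C := pow_le_pow_right₀ hn' (by omega)
  calc (60 * (n + 2) * (n + 2) + (60 * (n + 2)) + 20 : ℝ) ≤ 4000 * 1 * (n : ℝ) ^ 2 := by nlinarith
    _ ≤ _ := by gcongr

/-- Since `μ ≥ 2` gives `x = μ / ε ≥ 2`, constant factors inside the `k`-th power become powers of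
`x`: `3 * ⌈x⌉₊ ≤ x ^ 4`. Since `k ≥ 1`, the number of layers is also absorbed by `x ^ (4 * k)`. The
remaining constants sum to less than `4000`. -/
theorem full_time_le {C n μ k N : ℕ} {ε : ℝ} (hC : 4000 ≤ C) (hn : 1 ≤ n) (hμ : 2 ≤ μ)
    (hk : 1 ≤ k) (hε : 0 < ε) (hε1 : ε ≤ 1) (hN : (N : ℝ) ≤ (3 * (⌈μ / ε⌉₊ : ℕ)) ^ k) :
    (60 * (n + 2) * (n + 2) + (60 * (n + 2)) + 20 + (100 * (n + 2) * ((⌈μ / ε⌉₊ : ℕ) + μ + 2) +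
      200 * (n + 2) * (n + 2) * N) : ℝ) ≤ C * (μ / ε) ^ (C * k) * (n : ℝ) ^ C := by
  have hn' : (1 : ℝ) ≤ n := by exact_mod_cast hn
  have hμ' : (2 : ℝ) ≤ μ := by exact_mod_cast hμ
  have hC' : (4000 : ℝ) ≤ C := by exact_mod_cast hC
  set x : ℝ := μ / ε with hx
  have hμx : (μ : ℝ) ≤ x := by
    rw [hx, le_div_iff₀ hε]; nlinarith
  have hx2 : 2 ≤ x := hμ'.trans hμx
  have hρ : ((⌈x⌉₊ : ℕ) : ℝ) ≤ 2 * x := by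
    have := (Nat.ceil_lt_add_one (by linarith : 0 ≤ x)).le
    linarith
  have hNx : (N : ℝ) ≤ x ^ (4 * k) := by
    refine hN.trans ?_
    rw [pow_mul]
    gcongr
    have : (8 : ℝ) ≤ x ^ 3 := by nlinarith [pow_le_pow_left₀ (by norm_num : (0 : ℝ) ≤ 2) hx2 3]
    calc 3 * ((⌈x⌉₊ : ℕ) : ℝ) ≤ 8 * x := by linarith
      _ ≤ x ^ 3 * x := by gcongr
      _ = x ^ 4 := by ring
  set X := x ^ (4 * k) with hX
  have hxX : x ≤ X := le_self_pow₀ (by linarith) (by omega)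
  have h1 : X ≤ x ^ (C * k) := pow_le_pow_right₀ (by linarith) (Nat.mul_le_mul_right _ (by omega))
  have h2 : (n : ℝ) ^ 2 ≤ (n : ℝ) ^ C := pow_le_pow_right₀ hn' (by omega)
  have hX1 : 1 ≤ X := by linarith
  have hn3 : (n : ℝ) + 2 ≤ 3 * n := by linarith
  have hnn : (n : ℝ) ≤ (n : ℝ) ^ 2 := le_self_pow₀ hn' (by norm_num)
  have hsum : ((⌈x⌉₊ : ℕ) : ℝ) + μ + 2 ≤ 4 * X := by linarith
  have hY : (n : ℝ) ^ 2 * 1 ≤ (n : ℝ) ^ 2 * X := by gcongr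
  have a1 : (60 * (n + 2) * (n + 2) : ℝ) ≤ 60 * (3 * n) * (3 * n) := by gcongr
  have a2 : (100 * (n + 2) * ((⌈x⌉₊ : ℕ) + μ + 2) : ℝ) ≤ 100 * (3 * n) * (4 * X) := by gcongr
  have a3 : (200 * (n + 2) * (n + 2) * N : ℝ) ≤ 200 * (3 * n) * (3 * n) * X := by gcongr
  have a4 : (n : ℝ) * X ≤ (n : ℝ) ^ 2 * X := by gcongr
  have hn1 : 1 ≤ (n : ℝ) ^ 2 := one_le_pow₀ hn'
  calc _ ≤ 4000 * X * (n : ℝ) ^ 2 := by nlinarith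
    _ ≤ _ := by gcongr

/-- If the optimum is missed by a factor of at most `1 + ε`, then the solution is
`(1 - ε)`-approximate. -/
theorem one_sub_mul_le {a b ε : ℝ} (hε : 0 ≤ ε) (hε1 : ε ≤ 1) (hb : 0 ≤ b) (h : a ≤ (1 + ε) * b) :
    (1 - ε) * a ≤ b := by
  have h1 := mul_le_mul_of_nonneg_left h (sub_nonneg.2 hε1)
  nlinarith [mul_nonneg (mul_nonneg hε hε) hb]

theorem solvesWithin_main {C : ℕ} (hC : 4000 ≤ C) (hn : 1 ≤ n) (M : Matroid (Fin n))
    (hM : M.E = Set.univ) (k : ℕ) (hk : M.eRank = k) {U : Type*} (w : U → ℝ≥0)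
    (F : Fin n → Finset U) (μ : ℕ) (hμ : 1 ≤ μ) (hF : FrequencyBounded F μ) (ε : ℝ) (hε : 0 < ε)
    (hε1 : ε ≤ 1) :
    SolvesWithin main M w F μ ε (C * ((μ : ℝ) / ε) ^ (C * k) * (n : ℝ) ^ C) := by
  obtain ⟨m, rfl⟩ : ∃ m, μ = m + 1 := ⟨μ - 1, by omega⟩
  set O := oracles M w F
  have hO : ∀ S, O.indep S ↔ M.Indep S := fun _ => Iff.rfl
  have hV : ∀ S, O.value S = coverage w F S := fun _ => rfl
  obtain ⟨t₁, s₁, he₁, ht₁, ⟨e0, e1, e2⟩, harr, hsort⟩ := runs_sort (O := O) (μ := m + 1) (ε := ε)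
  obtain ⟨t₂, s₂, he₂, ht₂, a0, a1, a5, ar, aa⟩ := Runs.of_wp (O := O) (s := s₁)
    (p := .set 5 (.lit 1)) (Q := fun s => s.reg 0 = n ∧ s.reg 1 = m + 1 ∧ s.reg 5 = 1 ∧
      s.rreg = s₁.rreg ∧ s.arr = s₁.arr) (by simp [wp, NExp.eval, e0, e1])
  -- The all-zero labelling is a layering with no layers, which starts the construction.
  obtain ⟨t₃, s₃, he₃, ht₃, ⟨f0, f1, f5, fr, fa⟩, hL, hq, h6⟩ := runs_layer hM hO
    (c := fun v => coverage w F {v}) (i := 0) a0 a5 (by rw [aa]; exact hsort)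
    ⟨fun v => by simp [aa, harr], fun j h1 h2 => by omega, fun v _ j h1 h2 => by omega⟩
  have ht₂' : t₂ ≤ 2 := ht₂
  have hQI : M.Indep (s₃.query : Set (Fin n)) := by
    convert hL.indep 1 le_rfl le_rfl using 1
    ext v; simpa using hq v
  -- The test is needed for the time bound: if `k = 0` or `μ / ε` is close to `1`, the factor `(μ /
  -- ε) ^ (C * k)` leaves no room for `μ / ε` layers or an exhaustive search.
  by_cases hb : (Test.and (.le (.lit 2) (.var 1)) (.le (.lit 1) (.var 6))).Holds O s₃
  · have hb' : 2 ≤ m + 1 ∧ 1 ≤ s₃.reg 6 := by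
      simpa [Test.Holds, NExp.eval, f1, a1] using hb
    have hk1 : 1 ≤ k := (Nat.succ_le_of_lt (Finset.card_pos.2 (h6.2 hb'.2))).trans
      (card_le_of_indep hk hQI)
    obtain ⟨t₄, s₄, he₄, ht₄, g0, hL'⟩ := runs_layers hM hO (μ := m + 1) (ε := ε)
      (c := fun v => coverage w F {v}) hμ hε
      ⟨by rw [f0, a0], by rw [f1, a1], by rw [fr, ar, e2]⟩ (by rw [f5, a5])
      (by rw [fa, aa]; exact hsort) hL
    obtain ⟨t₅, s₅, he₅, ht₅, hI, hbest⟩ := runs_search (O := O) hO (by simp [hV]) g0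
    have hρ1 : 1 ≤ ⌈((m + 1 : ℕ) : ℝ) / ε⌉₊ := Nat.one_le_ceil_iff.2 (by positivity)
    refine ⟨_, s₅, Exec.seq he₁ (Exec.seq he₂ (Exec.seq he₃ (Exec.ite_true hb (Exec.seq he₄ he₅)))),
      ?_, hI, fun T hT => ?_⟩
    · refine le_trans ?_ (full_time_le (k := k) hC hn hb'.1 hk1 hε hε1
        (hL'.card_extensions_le hk hρ1))
      have : (Test.and (.le (.lit 2) (.var 1)) (.le (.lit 1) (.var 6))).cost = 7 := rfl
      rw [this]
      exact_mod_cast (by omega)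
    · obtain ⟨S, hSL, hSI, hS⟩ := hL'.exists_approx hF hρ1 T hT
      have h1 := hbest S hSL hSI
      rw [hV, hV] at h1
      set ρ := ⌈((m + 1 : ℕ) : ℝ) / ε⌉₊
      have hρ0 : (0 : ℝ) < ρ := by exact_mod_cast hρ1
      -- This converts the kernel factor `(ρ + m) / ρ` into `1 + ε`, using `m = μ - 1` and `ρ ≥ μ /
      -- ε`.
      have hm : (m : ℝ) ≤ ρ * ε := by
        have := Nat.le_ceil (((m + 1 : ℕ) : ℝ) / ε)
        rw [div_le_iff₀ hε] at this
        exact le_trans (by push_cast; linarith) this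
      refine one_sub_mul_le hε.le hε1 (coverage_nonneg w F _) ?_
      have h0 := coverage_nonneg w F S
      refine le_of_mul_le_mul_left ?_ hρ0
      calc ρ * coverage w F T ≤ (ρ + m) * coverage w F S := hS
        _ ≤ (ρ + ρ * ε) * coverage w F s₅.query := by gcongr
        _ = _ := by ring
  · refine ⟨_, s₃, Exec.seq he₁ (Exec.seq he₂ (Exec.seq he₃ (Exec.ite_false hb (Exec.skip _)))),
      ?_, hQI, fun T hT => ?_⟩
    · refine le_trans ?_ (early_time_le (k := k) hC hn hμ hε hε1)
      have : (Test.and (.le (.lit 2) (.var 1)) (.le (.lit 1) (.var 6))).cost = 7 := rfl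
      rw [this]
      exact_mod_cast (by omega)
    · obtain ⟨S, hSL, hSI, hS⟩ := hL.exists_approx hF le_rfl T hT
      have hSQ : S ⊆ s₃.query := fun v hv => (hq v).2 (by
        have h1 : s₃.arr 1 v ≠ 0 := hSL v hv
        have h2 : s₃.arr 1 v ≤ 0 + 1 := hL.le v
        omega)
      have h0 := coverage_nonneg w F s₃.query
      have hTnn := coverage_nonneg w F T
      suffices coverage w F T ≤ coverage w F s₃.query by nlinarith
      -- With `m = 0` a single layer loses nothing. Otherwise the first layer is empty, and the
      -- kernel bound forces every independent set to have value zero.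
      by_cases hm : m = 0
      · subst hm
        have := coverage_mono w F hSQ
        norm_num at hS
        linarith
      · have hempty : s₃.query = ∅ := by
          by_contra hne
          refine hb ?_
          have := h6.1 (Finset.nonempty_iff_ne_empty.2 hne)
          simp only [Test.Holds, NExp.eval, f1, a1]
          exact ⟨by omega, this⟩
        rw [hempty, Finset.subset_empty] at hSQ
        rw [hSQ] at hS
        norm_num at hS
        linarith

end Main

end MatroidCoverage

theorem mainTheorem2 :
    ∃ (P : MatroidCoverage.Prog) (C : ℕ),
      ∀ (n : ℕ) (_hn : 1 ≤ n)
        (M : Matroid (Fin n)) (_hM : M.E = Set.univ)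
        (k : ℕ) (_hk : M.eRank = k)
        (U : Type*) (w : U → NNReal) (F : Fin n → Finset U)
        (μ : ℕ) (_hμ : 1 ≤ μ) (_hF : MatroidCoverage.FrequencyBounded F μ)
        (ε : ℝ) (_hε₀ : 0 < ε) (_hε₁ : ε ≤ 1),
        MatroidCoverage.SolvesWithin P M w F μ ε
          ((C : ℝ) * ((μ : ℝ) / ε) ^ (C * k) * (n : ℝ) ^ C) :=
  ⟨MatroidCoverage.Algo.main, 4000, fun _ hn M hM k hk _ w F μ hμ hF ε hε hε1 =>
    MatroidCoverage.solvesWithin_main le_rfl hn M hM k hk w F μ hμ hF ε hε hε1⟩
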